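/- A chord diagram on $n$ chords is a perfect matching of the set $\{1,\dots,2n\}$ (equivalently, a fixed-point-free involution of it); its pairs $\{a<b\}$ are called chords. Two chords $\{v_1<v_2\}$ and $\{w_1<w_2\}$ cross if $v_1<w_1<v_2<w_2$ or $w_1<v_1<w_2<v_2$. The diagram is connected if its intersection graph, whose vertices are the chords and whose edges are the pairs of crossing chords, is connected and nonempty. It is $k$-connected if at least $k$ chords have to be deleted to make it disconnected, that is, if after the deletion of any set of fewer than $k$ chords the remaining chords still form a connected (in particular nonempty) diagram. Let $$C(x)=\sum_{n\ge 0}C_n x^n=x+x^2+4x^3+27x^4+\cdots,\qquad C_{\ge 2}(x)=\sum_{n\ge 0}(C_{\ge 2})_n x^n=x^2+x^3+7x^4+63x^5+\cdots,$$ where $C_n$ and $(C_{\ge 2})_n$ are the numbers of connected and of $2$-connected chord diagrams on $n$ chords. **Proposition 3.1.** The series $C(x)^2/x$ is a formal power series with integer coefficients and zero constant term, and $$C(x)=\frac{C(x)^2}{x}-C_{\ge 2}\!\left(\frac{C(x)^2}{x}\right)$$ as formal power series. -/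

import Mathlib

open PowerSeries

/-- A (rooted) chord diagram on `n` chords in its linear representation: a fixed-point-free
involution of the `2 * n` nodes, which pairs each node with the other end of its chord. -/
def ChordDiagram (n : ℕ) : Type :=
  {σ : Equiv.Perm (Fin (2 * n)) // (∀ i, σ (σ i) = i) ∧ ∀ i, σ i ≠ i}

namespace ChordDiagram

variable {n : ℕ}

/-- The chords `{a < b}` of a diagram, each listed once as the pair of its left node `a` and its
right node `b`. -/
def Chord (D : ChordDiagram n) : Type :=
  {c : Fin (2 * n) × Fin (2 * n) // c.1 < c.2 ∧ D.1 c.1 = c.2}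

/-- The left node of a chord. -/
def Chord.left {D : ChordDiagram n} (c : D.Chord) : Fin (2 * n) := c.1.1

/-- The right node of a chord. -/
def Chord.right {D : ChordDiagram n} (c : D.Chord) : Fin (2 * n) := c.1.2

/-- Two chords `{v₁ < v₂}` and `{w₁ < w₂}` cross if `v₁ < w₁ < v₂ < w₂` or
`w₁ < v₁ < w₂ < v₂`. -/
def Cross {D : ChordDiagram n} (c d : D.Chord) : Prop :=
  (c.left < d.left ∧ d.left < c.right ∧ c.right < d.right) ∨
    (d.left < c.left ∧ c.left < d.right ∧ d.right < c.right)

/-- The intersection graph: its vertices are the chords, and two chords are adjacent when they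
cross. -/
def intersectionGraph (D : ChordDiagram n) : SimpleGraph D.Chord where
  Adj c d := Cross c d
  symm := ⟨fun _ _ h => Or.symm h⟩
  loopless := ⟨fun c h => h.elim (fun h' => lt_irrefl c.left h'.1) (fun h' => lt_irrefl c.left h'.1)⟩

/-- A diagram is connected if its intersection graph is connected (in particular it has at least
one chord). -/
def IsConnected (D : ChordDiagram n) : Prop :=
  D.intersectionGraph.Connected

/-- A diagram is `k`-connected if at least `k` chords have to be deleted to make it disconnected:
after the deletion of any set `T` of fewer than `k` chords, the remaining chords still form a
connected diagram. The empty diagram is not connected, so a `k`-connected diagram with `1 ≤ k`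
has at least `k` chords. -/
def IsKConnected (D : ChordDiagram n) (k : ℕ) : Prop :=
  ∀ T : Set D.Chord, T.ncard < k → (D.intersectionGraph.induce Tᶜ).Connected

/-- The generating function `C(x)` of connected chord diagrams by the number of chords. -/
noncomputable def connectedGF : ℤ⟦X⟧ :=
  PowerSeries.mk fun n => (Nat.card {D : ChordDiagram n // D.IsConnected} : ℤ)

/-- The generating function `C_{≥ k}(x)` of `k`-connected chord diagrams by the number of
chords. -/
noncomputable def kConnectedGF (k : ℕ) : ℤ⟦X⟧ :=
  PowerSeries.mk fun n => (Nat.card {D : ChordDiagram n // D.IsKConnected k} : ℤ)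

end ChordDiagram

/-!
Delete the first node of a connected chord diagram on `n` chords. What remains is an *open diagram*:
an involution of the `2n - 1` other nodes with exactly one fixed point, the former partner of the
deleted root. Call a node of an interval `I` a *leg* if its chord leaves `I` (or has lost its other
end), and call `I` a *pod* if it has exactly one leg.

The diagram is connected iff every nonempty interval of the open diagram has a leg
(`ChordDiagram.isOpenConnected_toOpen_iff`): a component of the intersection graph that avoids the
root chord sits in a gap of the root component, and this gap is an interval matched within itself.
It is `2`-connected iff moreover it has at least two chords and the only pods are the singletons and
the whole (`ChordDiagram.isSimple_toOpen_iff`), since the chord through the leg of any other pod is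
a cut vertex. Such open diagrams are called *simple*.

Two pods of a connected open diagram never overlap without one containing the other
(`OpenDiagram.IsOpenConnected.subset_or_subset`). So, if there is more than one node, the maximal
proper pods cut the nodes into consecutive intervals. Each is a connected open diagram, and
contracting each to its leg leaves a simple open diagram; conversely, any such data glue back
uniquely. This is a substitution decomposition (`OpenDiagram.numOpen_eq_sum`). With `F` and `S` the
generating functions of connected and of simple open diagrams by the number of nodes it reads
`F = X + S(F)` (`OpenDiagram.openGF_eq`).

Counting chords instead of nodes, `C(X²) = X F` and `C_{≥ 2}(X²) = X S`. Hence `T = C² / X` satisfies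
`T(X²) = F²`, and multiplying `F = X + S(F)` by `F` gives `T(X²) = C(X²) + C_{≥ 2}(T(X²))`, which is
the claim after the injective substitution `X ↦ X²`.
-/

namespace OpenDiagram

open Set Function

/-! ### Legs of a set under an involution -/

section Legs

variable {α : Type*} {τ : α → α} {I J : Set α} {a b c : α}

/-- A leg of a set `I` of nodes under the involution `τ`: a node of `I` that `τ` either fixes or
sends out of `I`. A fixed point of `τ` stands for a node whose partner is the deleted root, so a
fixed node counts as leaving every set that contains it. -/
def IsLeg (τ : α → α) (I : Set α) (a : α) : Prop :=
  a ∈ I ∧ (τ a ∈ I → τ a = a)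

lemma isLeg_univ : IsLeg τ univ a ↔ τ a = a := by simp [IsLeg]

lemma isLeg_singleton : IsLeg τ {a} b ↔ b = a := by
  simp only [IsLeg, mem_singleton_iff]
  constructor
  · exact fun h => h.1
  · rintro rfl
    exact ⟨rfl, id⟩

/-- The asymmetric half of `false_of_existsUnique_isLeg`: the leg `u` of the whole lies in the
first two of the three sets. -/
lemma false_of_isLeg_inner {A B C : Set α} (hτ : Involutive τ) (hAB : Disjoint A B)
    (hBC : Disjoint B C) (hAC : Disjoint A C) (hA : ∃ a, IsLeg τ A a) (hB : ∃ a, IsLeg τ B a)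
    (hC : ∃ a, IsLeg τ C a) (h₁ : ∃! a, IsLeg τ (A ∪ B) a) (h₂ : ∃! a, IsLeg τ (B ∪ C) a)
    {u : α} (hu : IsLeg τ (A ∪ B ∪ C) u) (hu' : u ∈ A ∪ B) : False := by
  rw [Set.disjoint_left] at hAB hBC hAC
  have e₁ : ∀ x, IsLeg τ (A ∪ B) x → x = u := fun x hx =>
    h₁.unique hx ⟨hu', fun h => hu.2 (Or.inl h)⟩
  rcases hu' with huA | huB
  · -- the leg of `B` is joined to `A`, hence is the leg of `B ∪ C`
    obtain ⟨w, hwB, hw⟩ := hB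
    have hwA : τ w ∈ A := by
      by_contra hwA
      have := e₁ w ⟨Or.inr hwB, fun h => hw (h.resolve_left hwA)⟩
      exact hAB huA (this ▸ hwB)
    obtain ⟨z, hzC, hz⟩ := hC
    have hzB : τ z ∈ B := by
      by_contra hzB
      have := h₂.unique (y₁ := z) (y₂ := w) ⟨Or.inr hzC, fun h => hz (h.resolve_left hzB)⟩
        ⟨Or.inl hwB, fun h => (h.elim (hAB hwA) (hAC hwA)).elim⟩
      exact hBC hwB (this ▸ hzC)
    have := e₁ (τ z) ⟨Or.inr hzB, fun h => by
      rw [hτ z] at h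
      exact (h.elim (fun h => hAC h hzC) (fun h => hBC h hzC)).elim⟩
    exact hAB huA (this ▸ hzB)
  · -- the leg of `A` is joined to `B`, hence to the leg `u` of `B ∪ C`, but `u` leaves the whole
    obtain ⟨w, hwA, hw⟩ := hA
    have hwB : τ w ∈ B := by
      by_contra hwB
      have := e₁ w ⟨Or.inl hwA, fun h => hw (h.resolve_right hwB)⟩
      exact hAB hwA (this ▸ huB)
    have h := h₂.unique (y₁ := τ w) (y₂ := u) ⟨Or.inl hwB, fun h => by
      rw [hτ w] at h
      exact (h.elim (hAB hwA) (hAC hwA)).elim⟩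
      ⟨Or.inl huB, fun h => hu.2 (h.elim (fun h => Or.inl (Or.inr h)) Or.inr)⟩
    have h' : τ u = w := by rw [← h, hτ w]
    have := hu.2 (Or.inl (Or.inl (h' ▸ hwA)))
    exact hAB hwA (h' ▸ this.symm ▸ huB)

/-- Count the pairs of `τ` between `A`, `B`, `C` and the rest: it is impossible that `A ∪ B` and
`B ∪ C` have one leg each while `A`, `B`, `C` and their union all have legs. With
`A = I \ J`, `B = I ∩ J`, `C = J \ I` this forbids overlapping pods. -/
lemma false_of_existsUnique_isLeg {A B C : Set α} (hτ : Involutive τ) (hAB : Disjoint A B)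
    (hBC : Disjoint B C) (hAC : Disjoint A C) (hA : ∃ a, IsLeg τ A a) (hB : ∃ a, IsLeg τ B a)
    (hC : ∃ a, IsLeg τ C a) (hABC : ∃ a, IsLeg τ (A ∪ B ∪ C) a)
    (h₁ : ∃! a, IsLeg τ (A ∪ B) a) (h₂ : ∃! a, IsLeg τ (B ∪ C) a) : False := by
  obtain ⟨u, hu⟩ := hABC
  rcases hu.1 with hu' | hu'
  · exact false_of_isLeg_inner hτ hAB hBC hAC hA hB hC h₁ h₂ hu hu'
  · refine false_of_isLeg_inner (A := C) (B := B) (C := A) hτ hBC.symm hAB.symm hAC.symm hC hB hA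
      (by rwa [union_comm]) (by rwa [union_comm]) (u := u) ?_ (Or.inl hu')
    rwa [union_comm C B, union_comm, ← union_assoc]

end Legs

/-! ### Intervals of a linear order -/

section Intervals

variable {α : Type*} [LinearOrder α] {I J : Set α}

lemma ordConnected_diff (hI : I.OrdConnected) (hJ : J.OrdConnected) (h : ¬ J ⊆ I) :
    (I \ J).OrdConnected := by
  obtain ⟨z, hzJ, hzI⟩ := not_subset.1 h
  refine ⟨fun x hx y hy w hw => ⟨hI.out hx.1 hy.1 hw, fun hwJ => ?_⟩⟩
  rcases lt_or_ge z x with hzx | hxz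
  · exact hx.2 (hJ.out hzJ hwJ ⟨hzx.le, hw.1⟩)
  · rcases lt_or_ge y z with hyz | hzy
    · exact hy.2 (hJ.out hwJ hzJ ⟨hw.2, hyz.le⟩)
    · exact hzI (hI.out hx.1 hy.1 ⟨hxz, hzy⟩)

lemma ordConnected_union (hI : I.OrdConnected) (hJ : J.OrdConnected) (h : (I ∩ J).Nonempty) :
    (I ∪ J).OrdConnected := by
  obtain ⟨z, hzI, hzJ⟩ := h
  refine ⟨fun x hx y hy w hw => ?_⟩
  rcases le_total z w with hzw | hzw
  · rcases hy with hy | hy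
    · exact Or.inl (hI.out hzI hy ⟨hzw, hw.2⟩)
    · exact Or.inr (hJ.out hzJ hy ⟨hzw, hw.2⟩)
  · rcases hx with hx | hx
    · exact Or.inl (hI.out hx hzI ⟨hw.1, hzw⟩)
    · exact Or.inr (hJ.out hx hzJ ⟨hw.1, hzw⟩)

lemma ordConnected_image {κ : Type*} [LinearOrder κ] {q : α → κ} (hq : Monotone q)
    (hs : Surjective q) (hI : I.OrdConnected) : (q '' I).OrdConnected := by
  refine ⟨?_⟩
  rintro _ ⟨x, hx, rfl⟩ _ ⟨y, hy, rfl⟩ z hz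
  obtain ⟨w, rfl⟩ := hs z
  rcases le_total w x with h | h
  · exact ⟨x, hx, le_antisymm hz.1 (hq h)⟩
  · rcases le_total y w with h' | h'
    · exact ⟨y, hy, le_antisymm (hq h') hz.2⟩
    · exact ⟨w, hI.out hx hy ⟨h, h'⟩, rfl⟩

lemma ordConnected_image_val {p : α → Prop} (hp : {x | p x}.OrdConnected) {J : Set {x // p x}}
    (hJ : J.OrdConnected) : (Subtype.val '' J).OrdConnected := by
  refine ⟨?_⟩
  rintro _ ⟨x, hx, rfl⟩ _ ⟨y, hy, rfl⟩ z hz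
  exact ⟨⟨z, hp.out x.2 y.2 hz⟩, hJ.out hx hy hz, rfl⟩

end Intervals

/-! ### Connected open diagrams and their pods -/

section Pods

variable {α : Type*} [LinearOrder α] {τ : α → α} {I J : Set α} {a b c : α}

/-- A connected open diagram: what is left of a connected chord diagram once its first node is
deleted. It is recorded as an involution `τ` whose unique fixed point is the node that loses its
partner; connectedness says that every nonempty interval of nodes has a leg. -/
structure IsOpenConnected (τ : α → α) : Prop where
  involutive : Involutive τ
  existsUnique_fixed : ∃! a, τ a = a
  exists_isLeg : ∀ I : Set α, I.OrdConnected → I.Nonempty → ∃ a, IsLeg τ I a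

/-- A pod: an interval of nodes with exactly one leg. -/
def IsPod (τ : α → α) (I : Set α) : Prop :=
  I.OrdConnected ∧ ∃! a, IsLeg τ I a

/-- A simple open diagram: a connected one with more than one node, whose only pods are the
singletons and the whole. These correspond to the `2`-connected chord diagrams. -/
structure IsSimple (τ : α → α) : Prop where
  isOpenConnected : IsOpenConnected τ
  nontrivial : Nontrivial α
  pod : ∀ I, IsPod τ I → I.Subsingleton ∨ I = univ

lemma IsPod.nonempty (h : IsPod τ I) : I.Nonempty :=
  let ⟨a, ha, _⟩ := h.2
  ⟨a, ha.1⟩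

lemma isPod_singleton (τ : α → α) (a : α) : IsPod τ {a} :=
  ⟨ordConnected_singleton, a, isLeg_singleton.2 rfl, fun _ h => isLeg_singleton.1 h⟩

/-- Pods of a connected open diagram form a laminar family. -/
lemma IsOpenConnected.subset_or_subset (hτ : IsOpenConnected τ) (hI : IsPod τ I) (hJ : IsPod τ J)
    (h : (I ∩ J).Nonempty) : I ⊆ J ∨ J ⊆ I := by
  by_contra! hc
  refine false_of_existsUnique_isLeg (A := I \ J) (B := I ∩ J) (C := J \ I) hτ.involutive
    disjoint_sdiff_inter
    (by rw [inter_comm]; exact disjoint_sdiff_inter.symm)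
    (Set.disjoint_left.2 fun x hx hx' => hx'.2 hx.1)
    (hτ.exists_isLeg _ (ordConnected_diff hI.1 hJ.1 hc.2) (nonempty_of_not_subset hc.1))
    (hτ.exists_isLeg _ (hI.1.inter hJ.1) h)
    (hτ.exists_isLeg _ (ordConnected_diff hJ.1 hI.1 hc.1) (nonempty_of_not_subset hc.2))
    ?_ ?_ ?_
  · rw [sdiff_union_inter, union_sdiff_self]
    exact hτ.exists_isLeg _ (ordConnected_union hI.1 hJ.1 h) (hI.nonempty.inl)
  · rw [sdiff_union_inter]
    exact hI.2
  · rw [inter_comm, inter_union_sdiff]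
    exact hJ.2

/-- Two nodes are related if some proper pod contains both. -/
def SamePod (τ : α → α) (a b : α) : Prop :=
  ∃ I, IsPod τ I ∧ I ≠ univ ∧ a ∈ I ∧ b ∈ I

/-- By laminarity, the class of a node under `SamePod` is the largest proper pod containing it. -/
lemma IsOpenConnected.isPod_samePod [Finite α] [Nontrivial α] (hτ : IsOpenConnected τ) (a : α) :
    IsPod τ {b | SamePod τ a b} ∧ {b | SamePod τ a b} ≠ univ := by
  obtain ⟨M, hM⟩ := Set.Finite.exists_maximal
    (Set.toFinite {I : Set α | IsPod τ I ∧ I ≠ univ ∧ a ∈ I})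
    ⟨{a}, isPod_singleton τ a, by simp [Set.ext_iff, exists_ne a], rfl⟩
  have key : {b | SamePod τ a b} = M := by
    ext b
    constructor
    · rintro ⟨I, hI, hI', ha, hb⟩
      rcases hτ.subset_or_subset hI hM.prop.1 ⟨a, ha, hM.prop.2.2⟩ with h | h
      · exact h hb
      · exact hM.le_of_ge ⟨hI, hI', ha⟩ h hb
    · exact fun hb => ⟨M, hM.prop.1, hM.prop.2.1, hM.prop.2.2, hb⟩
  rw [key]
  exact ⟨hM.prop.1, hM.prop.2.1⟩

lemma SamePod.symm (h : SamePod τ a b) : SamePod τ b a :=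
  let ⟨I, h₁, h₂, h₃, h₄⟩ := h
  ⟨I, h₁, h₂, h₄, h₃⟩

lemma SamePod.refl [Nontrivial α] (τ : α → α) (a : α) : SamePod τ a a :=
  ⟨{a}, isPod_singleton τ a, by simp [Set.ext_iff, exists_ne a], rfl, rfl⟩

lemma IsOpenConnected.samePod_trans [Finite α] [Nontrivial α] (hτ : IsOpenConnected τ)
    (hab : SamePod τ a b) (hbc : SamePod τ b c) : SamePod τ a c :=
  ⟨{x | SamePod τ b x}, (hτ.isPod_samePod b).1, (hτ.isPod_samePod b).2, hab.symm, hbc⟩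

end Pods

/-! ### Contracting and gluing along fibers -/

section Decomposition

variable {α κ : Type*} {q : α → κ} {τ τ' : α → α} {D D' : κ → κ} {ℓ ℓ' : κ → α}

/-- `τ` is glued along the fibers of `q` from the involution `D` of the quotient: each fiber
`q ⁻¹' {i}` has the single leg `ℓ i`, `τ` acts on the legs as `D` does on the indices, and `τ` moves
all other nodes inside their fiber. -/
structure IsDecomp (q : α → κ) (τ : α → α) (D : κ → κ) (ℓ : κ → α) : Prop where
  proj_leg : ∀ i, q (ℓ i) = i
  map_leg : ∀ i, τ (ℓ i) = ℓ (D i)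
  map_of_ne : ∀ a, a ≠ ℓ (q a) → q (τ a) = q a ∧ τ a ≠ a

open Classical in
/-- The open diagram that `τ` induces on a fiber of `q`: a node that `τ` sends to another fiber
becomes a fixed point. -/
noncomputable def restrict (q : α → κ) (τ : α → α) (i : κ) (a : {a // q a = i}) :
    {a // q a = i} :=
  if h : q (τ a) = i then ⟨τ a, h⟩ else a

lemma restrict_of_eq {i : κ} {a : {a // q a = i}} (h : q (τ a) = i) :
    restrict q τ i a = ⟨τ a, h⟩ := dif_pos h

lemma restrict_of_ne {i : κ} {a : {a // q a = i}} (h : q (τ a) ≠ i) :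
    restrict q τ i a = a := dif_neg h

lemma isLeg_restrict {i : κ} {J : Set {a // q a = i}} {a : {a // q a = i}} :
    IsLeg (restrict q τ i) J a ↔ IsLeg τ (Subtype.val '' J) a := by
  by_cases h : q (τ a) = i
  · rw [IsLeg, IsLeg, restrict_of_eq h]
    simp [Subtype.ext_iff, h, a.2]
  · rw [IsLeg, IsLeg, restrict_of_ne h]
    simp [h, a.2]

lemma involutive_restrict (hτ : Involutive τ) (i : κ) : Involutive (restrict q τ i) := by
  intro a
  by_cases h : q (τ a) = i
  · rw [restrict_of_eq h, restrict_of_eq (by simp [hτ a.1, a.2])]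
    simp [hτ a.1]
  · rw [restrict_of_ne h, restrict_of_ne h]

namespace IsDecomp

lemma surjective (h : IsDecomp q τ D ℓ) : Surjective q := fun i => ⟨ℓ i, h.proj_leg i⟩

lemma leg_injective (h : IsDecomp q τ D ℓ) : Injective ℓ :=
  LeftInverse.injective h.proj_leg

/-- The legs of a union of fibers are the `ℓ i` with `i` a leg of the quotient diagram. -/
lemma isLeg_preimage (h : IsDecomp q τ D ℓ) {J : Set κ} {a : α} :
    IsLeg τ (q ⁻¹' J) a ↔ ∃ i, IsLeg D J i ∧ ℓ i = a := by
  constructor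
  · rintro ⟨ha, ha'⟩
    have e : a = ℓ (q a) := by
      by_contra hne
      obtain ⟨h₁, h₂⟩ := h.map_of_ne a hne
      exact h₂ (ha' (by simpa [h₁] using ha))
    refine ⟨q a, ⟨ha, fun hD => ?_⟩, e.symm⟩
    have e' : τ a = ℓ (D (q a)) := by rw [← h.map_leg, ← e]
    have := ha' (by simpa [e', h.proj_leg] using hD)
    rw [← h.proj_leg (D (q a)), ← e', this]
  · rintro ⟨i, ⟨hi, hi'⟩, rfl⟩
    refine ⟨by simpa [h.proj_leg] using hi, fun hD => ?_⟩
    rw [h.map_leg] at hD ⊢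
    rw [hi' (by simpa [h.proj_leg] using hD)]

lemma existsUnique_isLeg_preimage (h : IsDecomp q τ D ℓ) {J : Set κ} :
    (∃! a, IsLeg τ (q ⁻¹' J) a) ↔ ∃! i, IsLeg D J i := by
  constructor
  · rintro ⟨a, ha, hu⟩
    obtain ⟨i, hi, rfl⟩ := h.isLeg_preimage.1 ha
    exact ⟨i, hi, fun j hj => h.leg_injective (hu _ (h.isLeg_preimage.2 ⟨j, hj, rfl⟩))⟩
  · rintro ⟨i, hi, hu⟩
    refine ⟨ℓ i, h.isLeg_preimage.2 ⟨i, hi, rfl⟩, fun a ha => ?_⟩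
    obtain ⟨j, hj, rfl⟩ := h.isLeg_preimage.1 ha
    rw [hu j hj]

lemma isLeg_fiber (h : IsDecomp q τ D ℓ) {i : κ} {a : α} :
    IsLeg τ (q ⁻¹' {i}) a ↔ a = ℓ i := by
  rw [h.isLeg_preimage]
  simp [isLeg_singleton, eq_comm]

lemma restrict_eq_self_iff (h : IsDecomp q τ D ℓ) {i : κ} {a : {a // q a = i}} :
    restrict q τ i a = a ↔ a.1 = ℓ i := by
  rw [← isLeg_univ, isLeg_restrict, ← h.isLeg_fiber]
  have : Subtype.val '' (univ : Set {a // q a = i}) = q ⁻¹' {i} := by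
    ext; simp
  rw [this]

lemma existsUnique_restrict_eq_self (h : IsDecomp q τ D ℓ) (i : κ) :
    ∃! a, restrict q τ i a = a :=
  ⟨⟨ℓ i, h.proj_leg i⟩, h.restrict_eq_self_iff.2 rfl,
    fun _ ha => Subtype.ext (h.restrict_eq_self_iff.1 ha)⟩

lemma contract_unique (h : IsDecomp q τ D ℓ) (h' : IsDecomp q τ D' ℓ') : D = D' := by
  have e : ℓ = ℓ' := funext fun i => h'.isLeg_fiber.1 (h.isLeg_fiber.2 rfl)
  subst e
  funext i
  rw [← h.proj_leg (D i), ← h.map_leg, h'.map_leg, h'.proj_leg]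

lemma eq_of_restrict_eq (h : IsDecomp q τ D ℓ) (h' : IsDecomp q τ' D ℓ')
    (hr : ∀ i, restrict q τ i = restrict q τ' i) : τ = τ' := by
  have e : ℓ = ℓ' := funext fun i => by
    refine h'.restrict_eq_self_iff (a := ⟨ℓ i, h.proj_leg i⟩).1 ?_
    rw [← hr]
    exact h.restrict_eq_self_iff.2 rfl
  subst e
  funext a
  by_cases ha : a = ℓ (q a)
  · rw [ha, h.map_leg, h'.map_leg]
  · have := congr_fun (hr (q a)) ⟨a, rfl⟩
    rwa [restrict_of_eq (h.map_of_ne a ha).1, restrict_of_eq (h'.map_of_ne a ha).1,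
      Subtype.mk.injEq] at this

lemma involutive_iff (h : IsDecomp q τ D ℓ) :
    Involutive τ ↔ Involutive D ∧ ∀ i, Involutive (restrict q τ i) := by
  refine ⟨fun hτ => ⟨fun i => h.leg_injective ?_, involutive_restrict hτ⟩, fun ⟨hD, hr⟩ a => ?_⟩
  · rw [← h.map_leg, ← h.map_leg, hτ]
  · by_cases ha : a = ℓ (q a)
    · rw [ha, h.map_leg, h.map_leg, hD]
    · obtain ⟨h₁, h₂⟩ := h.map_of_ne a ha
      have e : restrict q τ (q a) ⟨a, rfl⟩ = ⟨τ a, h₁⟩ := restrict_of_eq h₁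
      have e' := hr (q a) ⟨a, rfl⟩
      rw [e] at e'
      by_cases h₃ : q (τ (τ a)) = q a
      · rw [restrict_of_eq h₃] at e'
        exact congr_arg Subtype.val e'
      · rw [restrict_of_ne h₃] at e'
        exact absurd (congr_arg Subtype.val e') h₂

end IsDecomp

/-- Gluing: a quotient diagram `D` and one diagram with a unique fixed point on each fiber come
from an involution `τ` of all nodes. -/
lemma exists_isDecomp (q : α → κ) (D : κ → κ) (o : ∀ i, {a // q a = i} → {a // q a = i})
    (ho : ∀ i, ∃! a, o i a = a) :
    ∃ τ ℓ, IsDecomp q τ D ℓ ∧ ∀ i, restrict q τ i = o i := by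
  classical
  choose m hm hu using ho
  let τ : α → α := fun a =>
    if o (q a) ⟨a, rfl⟩ = ⟨a, rfl⟩ then (m (D (q a))).1 else (o (q a) ⟨a, rfl⟩).1
  have hfix : ∀ i (a : {a // q a = i}), o i a = a → τ a = m (D i) := by
    rintro _ ⟨a, rfl⟩ h
    exact if_pos h
  have hmove : ∀ i (a : {a // q a = i}), o i a ≠ a → τ a = o i a := by
    rintro _ ⟨a, rfl⟩ h
    exact if_neg h
  refine ⟨τ, fun i => m i, ⟨fun i => (m i).2, fun i => hfix i _ (hm i), fun a ha => ?_⟩,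
    fun i => funext fun a => ?_⟩
  · have h : o (q a) ⟨a, rfl⟩ ≠ ⟨a, rfl⟩ := fun h => ha (congr_arg Subtype.val (hu _ _ h))
    rw [hmove _ ⟨a, rfl⟩ h]
    exact ⟨(o (q a) ⟨a, rfl⟩).2, fun h' => h (Subtype.ext h')⟩
  · by_cases h : o i a = a
    · by_cases h' : D i = i
      · have e : τ a = a := by rw [hfix i a h, h', ← hu _ _ h]
        rw [restrict_of_eq (by rw [e, a.2]), h]
        exact Subtype.ext e
      · rw [restrict_of_ne (by rw [hfix i a h, (m (D i)).2]; exact h'), h]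
    · have e := hmove i a h
      rw [restrict_of_eq (by rw [e, (o i a).2])]
      exact Subtype.ext e

lemma exists_isDecomp_of_existsUnique_isLeg (hτ : Involutive τ)
    (h : ∀ i, ∃! a, IsLeg τ (q ⁻¹' {i}) a) : ∃ D ℓ, IsDecomp q τ D ℓ := by
  choose ℓ hℓ hu using h
  refine ⟨fun i => q (τ (ℓ i)), ℓ, fun i => (hℓ i).1, fun i => hu _ _ ⟨rfl, fun h => ?_⟩,
    fun a ha => ?_⟩
  · rw [hτ] at h ⊢
    rw [mem_preimage, mem_singleton_iff, (hℓ i).1] at h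
    exact ((hℓ i).2 h.symm).symm
  · have : ¬ IsLeg τ (q ⁻¹' {q a}) a := fun h => ha (hu _ _ h)
    simpa [IsLeg] using this

end Decomposition

/-! ### Decompositions into intervals -/

section DecompositionOrder

variable {α κ : Type*} [LinearOrder α] [LinearOrder κ] {q : α → κ} {τ : α → α} {D : κ → κ}
  {ℓ : κ → α}

namespace IsDecomp

lemma isPod_preimage_iff (h : IsDecomp q τ D ℓ) (hq : Monotone q) {J : Set κ} :
    IsPod τ (q ⁻¹' J) ↔ IsPod D J := by
  rw [IsPod, IsPod, h.existsUnique_isLeg_preimage]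
  refine and_congr_left fun _ => ⟨fun hJ => ?_, fun hJ => hJ.preimage_mono hq⟩
  rw [← image_preimage_eq J h.surjective]
  exact ordConnected_image hq h.surjective hJ

/-- A glued diagram is connected iff the quotient and all fiber diagrams are. -/
lemma isOpenConnected_iff (h : IsDecomp q τ D ℓ) (hq : Monotone q) :
    IsOpenConnected τ ↔ IsOpenConnected D ∧ ∀ i, IsOpenConnected (restrict q τ i) := by
  have hfix : (∃! a, τ a = a) ↔ ∃! i, D i = i := by
    simpa [isLeg_univ] using h.existsUnique_isLeg_preimage (J := univ)
  constructor
  · intro hτ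
    have hinv := h.involutive_iff.1 hτ.involutive
    refine ⟨⟨hinv.1, hfix.1 hτ.existsUnique_fixed, fun J hJ hne => ?_⟩, fun i =>
      ⟨hinv.2 i, h.existsUnique_restrict_eq_self i, fun J hJ hne => ?_⟩⟩
    · obtain ⟨a, ha⟩ := hτ.exists_isLeg (q ⁻¹' J) (hJ.preimage_mono hq)
        (hne.preimage h.surjective)
      obtain ⟨i, hi, -⟩ := h.isLeg_preimage.1 ha
      exact ⟨i, hi⟩
    · obtain ⟨a, ha⟩ := hτ.exists_isLeg (Subtype.val '' J) (ordConnected_image_val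
        (ordConnected_singleton.preimage_mono hq : (q ⁻¹' {i}).OrdConnected) hJ) (hne.image _)
      obtain ⟨b, -, rfl⟩ := ha.1
      exact ⟨b, isLeg_restrict.2 ha⟩
  · rintro ⟨hD, hr⟩
    refine ⟨h.involutive_iff.2 ⟨hD.involutive, fun i => (hr i).involutive⟩,
      hfix.2 hD.existsUnique_fixed, fun I hI hne => ?_⟩
    by_contra! hno
    -- if `I` has no leg, the leg of each trace of `I` on a fiber must be the leg of that fiber
    have key : ∀ i ∈ q '' I, ℓ i ∈ I := by
      rintro _ ⟨b, hb, rfl⟩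
      obtain ⟨x, hx⟩ := (hr (q b)).exists_isLeg (Subtype.val ⁻¹' I)
        (hI.preimage_mono (Subtype.mono_coe _)) ⟨⟨b, rfl⟩, hb⟩
      have hxI : x.1 ∈ I := hx.1
      have hx' := isLeg_restrict.1 hx
      by_contra hℓ
      have hxℓ : x.1 ≠ ℓ (q x.1) := by
        intro e
        rw [x.2] at e
        exact hℓ (e ▸ hxI)
      obtain ⟨h₁, h₂⟩ := h.map_of_ne x.1 hxℓ
      refine hno x.1 ⟨hxI, fun hτx => hx'.2 ⟨⟨τ x.1, h₁.trans x.2⟩, hτx, rfl⟩⟩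
    obtain ⟨i, hi, hi'⟩ := hD.exists_isLeg (q '' I) (ordConnected_image hq h.surjective hI)
      (hne.image _)
    refine hno (ℓ i) ⟨key i hi, fun hτ => ?_⟩
    rw [h.map_leg] at hτ ⊢
    rw [hi' ⟨_, hτ, h.proj_leg _⟩]

/-- The fibers are the maximal proper pods exactly when the quotient diagram is simple. -/
lemma isSimple_iff [Finite α] (h : IsDecomp q τ D ℓ) (hq : Monotone q) (hτ : IsOpenConnected τ)
    [Nontrivial α] :
    (∀ a b, q a = q b ↔ SamePod τ a b) ↔ IsSimple D := by
  have hfib : ∀ i, IsPod τ (q ⁻¹' {i}) := fun i =>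
    (h.isPod_preimage_iff hq).2 (isPod_singleton D i)
  constructor
  · intro hker
    refine ⟨((h.isOpenConnected_iff hq).1 hτ).1, ?_, fun J hJ => ?_⟩
    · obtain ⟨a⟩ : Nonempty α := inferInstance
      obtain ⟨b, hb⟩ := (ne_univ_iff_exists_notMem _).1 (hτ.isPod_samePod a).2
      exact ⟨q a, q b, fun e => hb ((hker a b).1 e)⟩
    · rw [or_iff_not_imp_right]
      intro hJ' i hi j hj
      rw [← h.proj_leg i, ← h.proj_leg j, hker]
      refine ⟨q ⁻¹' J, (h.isPod_preimage_iff hq).2 hJ, fun e => hJ' ?_, ?_, ?_⟩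
      · rw [← image_preimage_eq J h.surjective, e, image_univ, h.surjective.range_eq]
      · simpa [h.proj_leg] using hi
      · simpa [h.proj_leg] using hj
  · intro hD a b
    constructor
    · intro e
      refine ⟨q ⁻¹' {q a}, hfib _, fun hu => ?_, rfl, e.symm⟩
      have := hD.nontrivial
      obtain ⟨i, hi⟩ := exists_ne (q a)
      have : ℓ i ∈ q ⁻¹' {q a} := hu ▸ mem_univ _
      exact hi (by simpa [h.proj_leg] using this)
    · rintro ⟨I, hI, hI', ha, hb⟩
      by_contra hab
      -- `I` contains every fiber that it meets
      have hsub : ∀ x ∈ I, q ⁻¹' {q x} ⊆ I := by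
        intro x hx
        refine (hτ.subset_or_subset (hfib (q x)) hI ⟨x, rfl, hx⟩).resolve_right fun hs => ?_
        exact hab ((hs ha : q a = q x).trans (hs hb : q b = q x).symm)
      have e : q ⁻¹' (q '' I) = I := by
        refine Subset.antisymm ?_ (subset_preimage_image q I)
        rintro y ⟨x, hx, hxy⟩
        exact hsub x hx hxy.symm
      rcases hD.pod (q '' I) ((h.isPod_preimage_iff hq).1 (e.symm ▸ hI)) with hs | hs
      · exact hab (hs ⟨a, ha, rfl⟩ ⟨b, hb, rfl⟩)
      · exact hI' (by rw [← e, hs, preimage_univ])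

end IsDecomp

end DecompositionOrder

end OpenDiagram

/-! ### Compositions and interval partitions -/

section Compositions

open Function

variable {n : ℕ}

/-- A lower set of `Fin n` is the initial segment given by its cardinality. -/
lemma Fin.iff_lt_card_filter {p : Fin n → Prop} [DecidablePred p]
    (hp : ∀ a b, a ≤ b → p b → p a) (a : Fin n) :
    p a ↔ (a : ℕ) < (Finset.univ.filter p).card := by
  constructor
  · intro h
    have : (Finset.Iic a).card ≤ (Finset.univ.filter p).card :=
      Finset.card_le_card fun b hb => by simpa using hp b a (Finset.mem_Iic.1 hb) h
    rw [Fin.card_Iic] at this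
    omega
  · intro h
    by_contra ha
    have : (Finset.univ.filter p).card ≤ (Finset.Iio a).card :=
      Finset.card_le_card fun b hb => by
        rw [Finset.mem_Iio]
        by_contra hab
        exact ha (hp a b (not_lt.1 hab) (by simpa using hb))
    rw [Fin.card_Iio] at this
    omega

namespace Composition

lemma index_eq_iff (c : Composition n) {a : Fin n} {i : Fin c.length} :
    c.index a = i ↔ c.sizeUpTo i ≤ a ∧ (a : ℕ) < c.sizeUpTo (i + 1) := by
  have := c.mem_range_embedding_iff (j := a) (i := i)
  rw [c.mem_range_embedding_iff', eq_comm] at this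
  simpa using this

lemma monotone_index (c : Composition n) : Monotone c.index := by
  intro a b hab
  by_contra! h
  have h₁ := c.lt_sizeUpTo_index_succ b
  have h₂ := c.sizeUpTo_index_le a
  have h₃ : c.sizeUpTo (c.index b).succ ≤ c.sizeUpTo (c.index a) :=
    c.monotone_sizeUpTo (by simpa using h)
  have : (a : ℕ) ≤ b := hab
  omega

lemma surjective_index (c : Composition n) : Surjective c.index := fun i =>
  ⟨c.embedding i ⟨0, c.one_le_blocksFun i⟩, c.index_embedding i _⟩

lemma card_index_eq (c : Composition n) (i : Fin c.length) :
    Fintype.card {a // c.index a = i} = c.blocksFun i := by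
  have e : Fin (c.blocksFun i) ≃ {a // c.index a = i} :=
    Equiv.ofBijective (fun j => ⟨c.embedding i j, c.index_embedding i j⟩)
      ⟨fun j k h => (c.embedding i).injective (congr_arg Subtype.val h), by
        rintro ⟨a, rfl⟩
        exact ⟨c.invEmbedding a, Subtype.ext (c.embedding_comp_inv a)⟩⟩
  simpa using (Fintype.card_congr e).symm

end Composition

/-- A monotone surjection between finite ordinals is determined by its kernel. -/
lemma Monotone.fin_val_congr {k k' : ℕ} {q : Fin n → Fin k} {q' : Fin n → Fin k'}
    (hq : Monotone q) (hs : Surjective q) (hq' : Monotone q') (hs' : Surjective q')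
    (h : ∀ a b, q a = q b ↔ q' a = q' b) (a : Fin n) : (q a : ℕ) = q' a := by
  have zero : ∀ {k : ℕ} {q : Fin n → Fin k}, Monotone q → Surjective q → ∀ h0 : 0 < n,
      (q ⟨0, h0⟩ : ℕ) = 0 := by
    intro k q hq hs h0
    obtain ⟨b, hb⟩ := hs ⟨0, (Nat.zero_le _).trans_lt (q ⟨0, h0⟩).2⟩
    have : q ⟨0, h0⟩ ≤ q b := hq (Nat.zero_le _ : 0 ≤ (b : ℕ))
    rw [hb] at this
    exact Nat.le_zero.1 this
  have succ : ∀ {k : ℕ} {q : Fin n → Fin k}, Monotone q → Surjective q → ∀ m (hm : m + 1 < n),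
      q ⟨m + 1, hm⟩ ≠ q ⟨m, (Nat.lt_succ_self m).trans hm⟩ →
      (q ⟨m + 1, hm⟩ : ℕ) = q ⟨m, (Nat.lt_succ_self m).trans hm⟩ + 1 := by
    intro k q hq hs m hm hne
    set x : Fin n := ⟨m, (Nat.lt_succ_self m).trans hm⟩
    set y : Fin n := ⟨m + 1, hm⟩
    have hlt : q x < q y := lt_of_le_of_ne (hq (Nat.le_succ m)) hne.symm
    by_contra hgap
    have hlt' : (q x : ℕ) < q y := hlt
    obtain ⟨b, hb⟩ := hs ⟨q x + 1, lt_of_le_of_lt hlt (q y).2⟩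
    have hb' : (q b : ℕ) = q x + 1 := by rw [hb]
    rcases le_or_gt (b : ℕ) m with hbm | hbm
    · have : (q b : ℕ) ≤ q x := hq (show b ≤ x from hbm)
      omega
    · have : (q y : ℕ) ≤ q b := hq (show y ≤ b from hbm)
      omega
  obtain ⟨m, hm⟩ := a
  induction m with
  | zero => rw [zero hq hs, zero hq' hs']
  | succ m ih =>
    by_cases e : q ⟨m + 1, hm⟩ = q ⟨m, (Nat.lt_succ_self m).trans hm⟩
    · rw [e, (h _ _).1 e]
      exact ih _
    · rw [succ hq hs m hm e, succ hq' hs' m hm (fun e' => e ((h _ _).2 e')), ih]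

namespace Composition

lemma ext_of_index {c c' : Composition n}
    (h : ∀ a b, c.index a = c.index b ↔ c'.index a = c'.index b) : c = c' := by
  have hval : ∀ a, (c.index a : ℕ) = c'.index a :=
    c.monotone_index.fin_val_congr c.surjective_index c'.monotone_index c'.surjective_index h
  have hle : ∀ {c c' : Composition n}, (∀ a, (c.index a : ℕ) = c'.index a) →
      c.length ≤ c'.length := by
    intro c c' hval
    by_contra! hlt
    obtain ⟨a, ha⟩ := c.surjective_index ⟨_, hlt⟩
    have := hval a
    rw [ha] at this
    exact (c'.index a).2.ne this.symm
  refine Composition.ext (List.ext_getElem (le_antisymm (hle hval) (hle fun a => (hval a).symm))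
    fun i h₁ h₂ => ?_)
  have e₁ := c.card_index_eq ⟨i, h₁⟩
  have e₂ := c'.card_index_eq ⟨i, h₂⟩
  rw [blocksFun, List.get_eq_getElem] at e₁ e₂
  rw [← e₁, ← e₂]
  refine Fintype.card_congr (Equiv.subtypeEquivRight fun a => ?_)
  rw [Fin.ext_iff, Fin.ext_iff, hval]

lemma exists_index_eq {k : ℕ} {q : Fin n → Fin k} (hq : Monotone q) (hs : Surjective q) :
    ∃ c : Composition n, ∀ a, (c.index a : ℕ) = q a := by
  classical
  let c : Composition n :=
    { blocks := List.ofFn fun i => (Finset.univ.filter fun a => q a = i).card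
      blocks_pos := by
        intro m hm
        obtain ⟨i, rfl⟩ := (List.mem_ofFn' _ _).1 hm
        obtain ⟨a, ha⟩ := hs i
        exact Finset.card_pos.2 ⟨a, by simpa using ha⟩
      blocks_sum := by
        rw [List.sum_ofFn, ← Finset.card_eq_sum_card_fiberwise (fun _ _ => Finset.mem_coe.2
          (Finset.mem_univ _))]
        simp }
  have hlen : c.length = k := by simp [c, Composition.length]
  have hsize : ∀ i ≤ k, c.sizeUpTo i = (Finset.univ.filter fun a => (q a : ℕ) < i).card := by
    intro i
    induction i with
    | zero => simp
    | succ i ih =>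
      intro hi
      rw [c.sizeUpTo_succ (hlen ▸ hi), ih (by omega)]
      have e : c.blocks[i]'(show i < c.length from hlen ▸ hi) =
          (Finset.univ.filter fun a => q a = ⟨i, hi⟩).card := by
        simp [c]
      rw [e, ← Finset.card_union_of_disjoint]
      · congr 1
        ext a
        simp only [Finset.mem_union, Finset.mem_filter, Finset.mem_univ, true_and, Fin.ext_iff]
        omega
      · rw [Finset.disjoint_left]
        intro a
        simp only [Finset.mem_filter, Finset.mem_univ, true_and, Fin.ext_iff]
        omega
  have hmem : ∀ i ≤ k, ∀ a : Fin n, (q a : ℕ) < i ↔ (a : ℕ) < c.sizeUpTo i := by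
    intro i hi a
    rw [hsize i hi]
    exact Fin.iff_lt_card_filter (p := fun a => (q a : ℕ) < i)
      (fun x y hxy hy => lt_of_le_of_lt (hq hxy) hy) a
  refine ⟨c, fun a => ?_⟩
  have : c.index a = ⟨q a, hlen.symm ▸ (q a).2⟩ := by
    rw [c.index_eq_iff]
    refine ⟨?_, ?_⟩
    · rw [← not_lt, ← hmem _ (q a).2.le]
      exact lt_irrefl _
    · rw [← hmem _ (q a).2]
      exact Nat.lt_succ_self _
  rw [this]

/-- Compositions of `n` correspond to the equivalence relations on `Fin n` whose classes are
intervals. -/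
lemma existsUnique_index_eq_iff {r : Fin n → Fin n → Prop} (hr : Equivalence r)
    (hconv : ∀ a, {b | r a b}.OrdConnected) :
    ∃! c : Composition n, ∀ a b, c.index a = c.index b ↔ r a b := by
  classical
  -- send each element to the least element of its class, and rank these least elements
  have hne : ∀ a, (Finset.univ.filter (r a)).Nonempty := fun a =>
    ⟨a, by simpa using hr.refl a⟩
  let m : Fin n → Fin n := fun a => (Finset.univ.filter (r a)).min' (hne a)
  have hm : ∀ a, r a (m a) := fun a => by simpa using Finset.min'_mem _ (hne a)
  have hm' : ∀ a b, r a b → m a ≤ b := fun a b h => Finset.min'_le _ _ (by simpa using h)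
  have hker : ∀ a b, m a = m b ↔ r a b := by
    intro a b
    refine ⟨fun h => hr.trans (hm a) (h ▸ hr.symm (hm b)), fun h => le_antisymm ?_ ?_⟩
    · exact hm' _ _ (hr.trans h (hm b))
    · exact hm' _ _ (hr.trans (hr.symm h) (hm a))
  have hmono : Monotone m := by
    intro a b hab
    by_contra! h
    have : r b a := (hconv b).out (hm b) (hr.refl b) ⟨h.le.trans (hm' a a (hr.refl a)), hab⟩
    exact h.ne' ((hker a b).2 (hr.symm this))
  let Q : Finset (Fin n) := Finset.univ.image m
  let e := Q.orderIsoOfFin rfl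
  let q : Fin n → Fin Q.card := fun a => e.symm ⟨m a, Finset.mem_image_of_mem m (Finset.mem_univ a)⟩
  have hq : Monotone q := fun a b hab => e.symm.monotone (hmono hab)
  have hs : Surjective q := by
    intro i
    obtain ⟨a, -, ha⟩ := Finset.mem_image.1 (e i).2
    exact ⟨a, by simp only [q, ha]; exact e.symm_apply_apply i⟩
  obtain ⟨c, hc⟩ := exists_index_eq hq hs
  have hc' : ∀ a b, c.index a = c.index b ↔ r a b := by
    intro a b
    rw [Fin.ext_iff, hc, hc, ← Fin.ext_iff, ← hker]
    simp [q]
  exact ⟨c, hc', fun c' h => ext_of_index fun a b => by rw [h, hc']⟩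

end Composition

lemma PowerSeries.coeff_mk_pow_eq_sum_composition {R : Type*} [CommSemiring R] {f : ℕ → R}
    (hf : f 0 = 0) (k n : ℕ) :
    coeff n (mk f ^ k) =
      ∑ c ∈ Finset.univ.filter (fun c : Composition n => c.length = k), (c.blocks.map f).prod := by
  have h := coeff_prod (fun _ : Fin k => mk f) n Finset.univ
  rw [Finset.prod_const, Finset.card_univ, Fintype.card_fin] at h
  rw [h]
  simp only [coeff_mk]
  symm
  let L : Composition n → Fin k →₀ ℕ := fun c =>
    Finsupp.equivFunOnFinite.symm fun i => c.blocks.getD i 0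
  have hL : ∀ c : Composition n, c.length = k → c.blocks = List.ofFn (L c) := by
    intro c hc
    refine List.ext_getElem (by simpa using hc) fun i h₁ h₂ => ?_
    simp only [L, List.getElem_ofFn, Finsupp.coe_equivFunOnFinite_symm]
    exact (List.getD_eq_getElem _ _ h₁).symm
  -- as `f 0 = 0`, only the tuples of positive integers, that is the compositions, contribute
  refine Finset.sum_bij_ne_zero (fun c _ _ => L c) ?_ ?_ ?_ ?_
  · intro c hc _
    rw [Finset.mem_finsuppAntidiag]
    refine ⟨?_, Finset.subset_univ _⟩
    rw [← List.sum_ofFn, ← hL c (by simpa using hc), c.blocks_sum]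
  · intro c hc _ c' hc' _ heq
    refine Composition.ext ?_
    rw [hL c (by simpa using hc), hL c' (by simpa using hc'), heq]
  · intro l hl hne
    have hpos : ∀ i, 0 < l i := fun i => Nat.pos_of_ne_zero fun h0 =>
      hne (Finset.prod_eq_zero (Finset.mem_univ i) (by rw [h0, hf]))
    refine ⟨⟨List.ofFn l, ?_, ?_⟩, ?_, ?_, ?_⟩
    · intro m hm
      obtain ⟨i, rfl⟩ := (List.mem_ofFn' _ _).1 hm
      exact hpos i
    · rw [List.sum_ofFn]
      exact (Finset.mem_finsuppAntidiag.1 hl).1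
    · simp [Composition.length]
    · rw [List.map_ofFn, List.prod_ofFn]
      exact hne
    · ext i
      simp [L]
  · intro c hc _
    conv_lhs => rw [hL c (by simpa using hc)]
    rw [List.map_ofFn, List.prod_ofFn]
    rfl

end Compositions

namespace OpenDiagram

open Set Function

/-! ### Counting open diagrams by their maximal pods -/

section Counting

variable {α β κ : Type*} [LinearOrder α] [LinearOrder β] [LinearOrder κ]

lemma isOpenConnected_of_unique [Unique α] (τ : α → α) : IsOpenConnected τ :=
  ⟨fun _ => Subsingleton.elim _ _, ⟨default, Subsingleton.elim _ _, fun _ _ => Subsingleton.elim _ _⟩,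
    fun _ _ ⟨a, ha⟩ => ⟨a, ha, fun _ => Subsingleton.elim _ _⟩⟩

/-- Relabelling along an order isomorphism is the decomposition into one-node fibers. -/
lemma isDecomp_conj (e : α ≃o β) (τ : α → α) : IsDecomp e τ (e ∘ τ ∘ e.symm) e.symm :=
  ⟨e.apply_symm_apply, fun i => by simp, fun a ha => absurd (e.symm_apply_apply a).symm ha⟩

lemma isOpenConnected_conj_iff (e : α ≃o β) {τ : α → α} :
    IsOpenConnected (e ∘ τ ∘ e.symm) ↔ IsOpenConnected τ := by
  rw [(isDecomp_conj e τ).isOpenConnected_iff e.monotone]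
  refine (and_iff_left fun i => ?_).symm
  let _ : Unique {a // e a = i} :=
    ⟨⟨⟨e.symm i, e.apply_symm_apply i⟩⟩, fun a => Subtype.ext (e.symm_apply_eq.2 a.2.symm).symm⟩
  exact isOpenConnected_of_unique _

lemma IsSimple.of_conj (e : α ≃o β) {τ : α → α} (h : IsSimple (e ∘ τ ∘ e.symm)) : IsSimple τ := by
  refine ⟨(isOpenConnected_conj_iff e).1 h.isOpenConnected, ?_, fun I hI => ?_⟩
  · have := h.nontrivial
    exact e.toEquiv.nontrivial
  · have hI' : e ⁻¹' (e '' I) = I := preimage_image_eq I e.injective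
    rcases h.pod (e '' I) (((isDecomp_conj e τ).isPod_preimage_iff e.monotone).1
      (hI'.symm ▸ hI)) with h | h
    · exact Or.inl (hI' ▸ h.preimage e.injective)
    · exact Or.inr (by rw [← hI', h, preimage_univ])

lemma isSimple_conj_iff (e : α ≃o β) {τ : α → α} :
    IsSimple (e ∘ τ ∘ e.symm) ↔ IsSimple τ := by
  refine ⟨IsSimple.of_conj e, fun h => IsSimple.of_conj e.symm ?_⟩
  convert h
  funext a
  simp

/-- The number of connected open diagrams on `n` nodes. -/
noncomputable def numOpen (n : ℕ) : ℕ := Nat.card {τ : Fin n → Fin n // IsOpenConnected τ}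

/-- The number of simple open diagrams on `n` nodes. -/
noncomputable def numSimple (n : ℕ) : ℕ := Nat.card {τ : Fin n → Fin n // IsSimple τ}

lemma card_isOpenConnected [Fintype α] :
    Nat.card {τ : α → α // IsOpenConnected τ} = numOpen (Fintype.card α) := by
  have e : Fin (Fintype.card α) ≃o α := Fintype.orderIsoFinOfCardEq α rfl
  exact (Nat.card_congr ((e.toEquiv.arrowCongr e.toEquiv).subtypeEquiv fun τ =>
    (isOpenConnected_conj_iff e).symm)).symm

lemma card_isSimple [Fintype α] :
    Nat.card {τ : α → α // IsSimple τ} = numSimple (Fintype.card α) := by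
  have e : Fin (Fintype.card α) ≃o α := Fintype.orderIsoFinOfCardEq α rfl
  exact (Nat.card_congr ((e.toEquiv.arrowCongr e.toEquiv).subtypeEquiv fun τ =>
    (isSimple_conj_iff e).symm)).symm

/-- The connected open diagrams whose maximal proper pods are the fibers of `q` are counted by a
simple diagram on the quotient and a connected open diagram on each fiber. -/
lemma card_isOpenConnected_with_fibers [Finite α] [Nontrivial α] [Fintype κ] {q : α → κ}
    (hq : Monotone q) (hs : Surjective q) :
    Nat.card {τ : α → α // IsOpenConnected τ ∧ ∀ a b, q a = q b ↔ SamePod τ a b} =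
      Nat.card {D : κ → κ // IsSimple D} *
        ∏ i, Nat.card {o : {a // q a = i} → {a // q a = i} // IsOpenConnected o} := by
  have hex : ∀ τ : {τ : α → α // IsOpenConnected τ ∧ ∀ a b, q a = q b ↔ SamePod τ a b},
      ∃ D ℓ, IsDecomp q τ.1 D ℓ := by
    rintro ⟨τ, hτ, hker⟩
    refine exists_isDecomp_of_existsUnique_isLeg hτ.involutive fun i => ?_
    obtain ⟨a, rfl⟩ := hs i
    have : q ⁻¹' {q a} = {b | SamePod τ a b} := by
      ext b
      rw [mem_ofPred_eq, ← hker]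
      exact eq_comm
    rw [this]
    exact (hτ.isPod_samePod a).1.2
  choose D ℓ h using hex
  rw [← Nat.card_pi, ← Nat.card_prod]
  refine Nat.card_congr (Equiv.ofBijective (fun τ =>
    (⟨D τ, ((h τ).isSimple_iff hq τ.2.1).1 τ.2.2⟩,
      fun i => ⟨restrict q τ.1 i, (((h τ).isOpenConnected_iff hq).1 τ.2.1).2 i⟩)) ⟨?_, ?_⟩)
  · intro τ τ' e
    rw [Prod.mk.injEq, Subtype.mk.injEq] at e
    have h' := h τ'
    rw [← e.1] at h'
    exact Subtype.ext ((h τ).eq_of_restrict_eq h' fun i =>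
      congr_arg Subtype.val (congr_fun e.2 i))
  · rintro ⟨⟨D', hD'⟩, o⟩
    obtain ⟨τ, ℓ', hτ, hr⟩ := exists_isDecomp q D' (fun i => (o i).1)
      fun i => (o i).2.existsUnique_fixed
    have hconn : IsOpenConnected τ := (hτ.isOpenConnected_iff hq).2
      ⟨hD'.isOpenConnected, fun i => by rw [hr]; exact (o i).2⟩
    refine ⟨⟨τ, hconn, (hτ.isSimple_iff hq hconn).2 hD'⟩, Prod.ext (Subtype.ext ?_)
      (funext fun i => Subtype.ext (hr i))⟩
    exact (h _).contract_unique hτ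

/-- Substitution decomposition: sort the connected open diagrams by the composition of `n` into
their maximal proper pods. -/
lemma numOpen_eq_sum {n : ℕ} (hn : 2 ≤ n) :
    numOpen n = ∑ c : Composition n, numSimple c.length * (c.blocks.map numOpen).prod := by
  have : Nontrivial (Fin n) := Fin.nontrivial_iff_two_le.2 hn
  have hex : ∀ τ : {τ : Fin n → Fin n // IsOpenConnected τ},
      ∃! c : Composition n, ∀ a b, c.index a = c.index b ↔ SamePod τ.1 a b := fun τ =>
    Composition.existsUnique_index_eq_iff
      ⟨SamePod.refl τ.1, SamePod.symm, τ.2.samePod_trans⟩ fun a => (τ.2.isPod_samePod a).1.1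
  choose c hc hu using hex
  rw [numOpen, Nat.card_congr (Equiv.sigmaFiberEquiv c).symm, Nat.card_sigma]
  refine Finset.sum_congr rfl fun b _ => ?_
  have e : {τ // c τ = b} ≃ {τ : Fin n → Fin n //
      IsOpenConnected τ ∧ ∀ x y, b.index x = b.index y ↔ SamePod τ x y} :=
    (Equiv.subtypeEquivRight fun τ => ⟨fun h => h ▸ hc τ, fun h => (hu τ b h).symm⟩).trans
      (Equiv.subtypeSubtypeEquivSubtypeInter (fun τ => IsOpenConnected τ)
        fun τ => ∀ x y, b.index x = b.index y ↔ SamePod τ x y)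
  rw [Nat.card_congr e, card_isOpenConnected_with_fibers b.monotone_index b.surjective_index,
    card_isSimple, Fintype.card_fin, ← b.ofFn_blocksFun, List.map_ofFn, List.prod_ofFn]
  congr 1
  refine Finset.prod_congr rfl fun i _ => ?_
  rw [card_isOpenConnected, b.card_index_eq, comp_apply]

lemma numOpen_zero : numOpen 0 = 0 := by
  rw [numOpen, Nat.card_eq_zero]
  exact Or.inl ⟨fun τ => τ.2.existsUnique_fixed.exists.choose.elim0⟩

lemma numOpen_one : numOpen 1 = 1 := by
  rw [numOpen, Nat.card_eq_one_iff_unique]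
  exact ⟨inferInstance, ⟨id, isOpenConnected_of_unique _⟩⟩

lemma numSimple_of_lt_two {n : ℕ} (hn : n < 2) : numSimple n = 0 := by
  rw [numSimple, Nat.card_eq_zero]
  refine Or.inl ⟨fun τ => ?_⟩
  have := Fin.nontrivial_iff_two_le.1 τ.2.nontrivial
  omega

lemma odd_card_of_isOpenConnected [Fintype α] {τ : α → α} (h : IsOpenConnected τ) :
    Odd (Fintype.card α) := by
  obtain ⟨p, hp, hu⟩ := h.existsUnique_fixed
  let f : Function.End α := τ
  have hf : f ^ 2 ^ 1 = 1 := by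
    rw [pow_one, pow_two]
    exact funext h.involutive
  have e := Equiv.Perm.card_fixedPoints_modEq hf
  have : Fintype.card (fixedPoints f) = 1 :=
    Fintype.card_eq_one_iff.2 ⟨⟨p, hp⟩, fun x => Subtype.ext (hu _ x.2)⟩
  rw [Nat.odd_iff]
  exact e.trans (by rw [this])

lemma numOpen_of_even {n : ℕ} (hn : Even n) : numOpen n = 0 := by
  rw [numOpen, Nat.card_eq_zero]
  refine Or.inl ⟨fun τ => ?_⟩
  have := odd_card_of_isOpenConnected τ.2
  rw [Fintype.card_fin] at this
  exact Nat.not_odd_iff_even.2 hn this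

lemma numSimple_of_even {n : ℕ} (hn : Even n) : numSimple n = 0 := by
  rw [numSimple, Nat.card_eq_zero]
  refine Or.inl ⟨fun τ => ?_⟩
  have := odd_card_of_isOpenConnected τ.2.isOpenConnected
  rw [Fintype.card_fin] at this
  exact Nat.not_odd_iff_even.2 hn this

end Counting

/-! ### Generating functions of open diagrams -/

section GeneratingFunctions

/-- The generating function of connected open diagrams by the number of nodes. -/
noncomputable def openGF : ℤ⟦X⟧ := mk fun n => (numOpen n : ℤ)

/-- The generating function of simple open diagrams by the number of nodes. -/
noncomputable def simpleGF : ℤ⟦X⟧ := mk fun n => (numSimple n : ℤ)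

lemma constantCoeff_openGF : constantCoeff openGF = 0 := by
  rw [← coeff_zero_eq_constantCoeff_apply, openGF, coeff_mk, numOpen_zero, Nat.cast_zero]

lemma coeff_subst_openGF (n : ℕ) : coeff n (simpleGF.subst openGF) =
    ∑ c : Composition n, (numSimple c.length : ℤ) *
      (c.blocks.map fun k => (numOpen k : ℤ)).prod := by
  have hf : ((numOpen 0 : ℕ) : ℤ) = 0 := by rw [numOpen_zero, Nat.cast_zero]
  rw [coeff_subst' (HasSubst.of_constantCoeff_zero' constantCoeff_openGF),
    finsum_eq_sum_of_support_subset (s := Finset.range (n + 1))]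
  · rw [← Finset.sum_fiberwise_of_maps_to (t := Finset.range (n + 1))
      (g := fun c : Composition n => c.length)
      fun c _ => Finset.mem_range.2 (Nat.lt_succ_of_le c.length_le)]
    refine Finset.sum_congr rfl fun k _ => ?_
    rw [openGF, coeff_mk_pow_eq_sum_composition hf, simpleGF, coeff_mk, smul_eq_mul,
      Finset.mul_sum]
    refine Finset.sum_congr rfl fun c hc => ?_
    rw [(Finset.mem_filter.1 hc).2]
  · intro k hk
    rw [mem_support] at hk
    by_contra hkn
    refine hk ?_
    rw [openGF, coeff_mk_pow_eq_sum_composition hf, Finset.filter_eq_empty_iff.2,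
      Finset.sum_empty, smul_zero]
    intro c _ hc
    have := c.length_le
    simp at hkn
    omega

/-- The substitution decomposition as an identity of generating functions; the term `X` is the
one-node diagram, which has no proper pods. -/
theorem openGF_eq : openGF = X + simpleGF.subst openGF := by
  ext n
  rw [map_add, coeff_subst_openGF, openGF, coeff_mk, coeff_X]
  rcases Nat.lt_or_ge n 2 with hn | hn
  · rw [Finset.sum_eq_zero fun c _ => by
      rw [numSimple_of_lt_two (c.length_le.trans_lt hn), Nat.cast_zero, zero_mul]]
    interval_cases n
    · simp [numOpen_zero]
    · simp [numOpen_one]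
  · rw [if_neg (by omega), zero_add, numOpen_eq_sum hn]
    push_cast
    simp [List.map_map, Function.comp_def]

end GeneratingFunctions

end OpenDiagram

/-! ### Connectedness of chord diagrams through intervals -/

lemma SimpleGraph.Reachable.closed_under_adj {V : Type*} {G : SimpleGraph V} {P : V → Prop}
    (hP : ∀ x y, G.Adj x y → P x → P y) {u v : V} (h : G.Reachable u v) (hu : P u) : P v := by
  obtain ⟨w⟩ := h
  induction w with
  | nil => exact hu
  | cons hadj _ ih => exact ih (hP _ _ hadj hu)

namespace ChordDiagram

open Set Function

variable {n : ℕ} (D : ChordDiagram n)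

lemma apply_apply (a : Fin (2 * n)) : D.1 (D.1 a) = a := D.2.1 a

lemma apply_ne (a : Fin (2 * n)) : D.1 a ≠ a := D.2.2 a

variable {D}

lemma Chord.left_lt_right (c : D.Chord) : c.left < c.right := c.2.1

lemma Chord.apply_left (c : D.Chord) : D.1 c.left = c.right := c.2.2

lemma Chord.apply_right (c : D.Chord) : D.1 c.right = c.left := by
  rw [← c.apply_left, D.apply_apply]

lemma Chord.ext_left {c d : D.Chord} (h : c.left = d.left) : c = d :=
  Subtype.ext (Prod.ext h (by
    change c.right = d.right
    rw [← c.apply_left, ← d.apply_left, h]))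

lemma Chord.ext_right {c d : D.Chord} (h : c.right = d.right) : c = d :=
  Chord.ext_left (by rw [← c.apply_right, ← d.apply_right, h])

lemma Chord.left_ne_right (c d : D.Chord) : c.left ≠ d.right := by
  intro h
  have h' : c.right = d.left := by rw [← c.apply_left, ← d.apply_right, h]
  have h₁ := c.left_lt_right
  have h₂ := d.left_lt_right
  rw [h, h'] at h₁
  exact h₁.asymm h₂

lemma exists_chord (D : ChordDiagram n) (a : Fin (2 * n)) :
    ∃ c : D.Chord, c.left = a ∧ c.right = D.1 a ∨ c.left = D.1 a ∧ c.right = a := by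
  rcases lt_or_gt_of_ne (D.apply_ne a) with h | h
  · exact ⟨⟨(D.1 a, a), h, D.apply_apply a⟩, Or.inr ⟨rfl, rfl⟩⟩
  · exact ⟨⟨(a, D.1 a), h, rfl⟩, Or.inl ⟨rfl, rfl⟩⟩

lemma Cross.left_mem_iff {c d : D.Chord} (h : Cross c d) {I : Set (Fin (2 * n))}
    (hI : I.OrdConnected) (hc : c.left ∈ I ↔ c.right ∈ I) (hd : d.left ∈ I ↔ d.right ∈ I)
    (hcI : c.left ∈ I) : d.left ∈ I := by
  rcases h with h | h
  · exact hI.out hcI (hc.1 hcI) ⟨h.1.le, h.2.1.le⟩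
  · exact hd.2 (hI.out hcI (hc.1 hcI) ⟨h.2.1.le, h.2.2.le⟩)

/-- A set `W` of chords is connected iff no interval of nodes separates it, that is, every
interval containing both ends or no end of each chord in `W` contains all or none of `W`. -/
lemma connected_induce_iff {W : Set D.Chord} :
    (D.intersectionGraph.induce W).Connected ↔ W.Nonempty ∧ ∀ I : Set (Fin (2 * n)),
      I.OrdConnected → (∀ c ∈ W, c.left ∈ I ↔ c.right ∈ I) →
        (∀ c ∈ W, c.left ∈ I) ∨ ∀ c ∈ W, c.left ∉ I := by
  constructor
  · intro h
    refine ⟨?_, fun I hI hW => ?_⟩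
    · obtain ⟨c⟩ := h.nonempty
      exact ⟨c.1, c.2⟩
    · by_contra! hc
      obtain ⟨⟨c, hcW, hc⟩, d, hdW, hd⟩ := hc
      refine hc ((h.preconnected ⟨d, hdW⟩ ⟨c, hcW⟩).closed_under_adj
        (P := fun x => x.1.left ∈ I) (fun x y hxy hx => ?_) hd)
      exact Cross.left_mem_iff hxy hI (hW _ x.2) (hW _ y.2) hx
  · rintro ⟨hne, hW⟩
    have : Finite D.Chord := Subtype.finite
    obtain ⟨r, hrW, hr⟩ := Set.exists_min_image W Chord.left W.toFinite hne
    have hr' : ∀ c ∈ W, c ≠ r → r.left < c.left := fun c hc hcr =>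
      lt_of_le_of_ne (hr c hc) fun h => hcr (Chord.ext_left h.symm)
    let R : Set D.Chord :=
      {c | ∃ h : c ∈ W, (D.intersectionGraph.induce W).Reachable ⟨r, hrW⟩ ⟨c, h⟩}
    have hrR : r ∈ R := ⟨hrW, .refl _⟩
    have hRcross : ∀ c ∈ R, ∀ d ∈ W, d ∉ R → ¬ Cross c d := by
      rintro c ⟨hcW, hc⟩ d hdW hd hcd
      refine hd ⟨hdW, hc.trans (SimpleGraph.Adj.reachable ?_)⟩
      exact hcd
    rw [SimpleGraph.connected_iff_exists_forall_reachable]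
    refine ⟨⟨r, hrW⟩, fun x => ?_⟩
    by_contra hx
    have hxR : x.1 ∉ R := fun h => hx h.2
    -- the gap of the component of `r` that contains the left node of `x`
    let I : Set (Fin (2 * n)) :=
      {y | ∀ c ∈ R, c.left ∉ uIcc x.1.left y ∧ c.right ∉ uIcc x.1.left y}
    have hI : I.OrdConnected := by
      refine ⟨fun y hy z hz w hw c hc => ?_⟩
      have hsub : uIcc x.1.left w ⊆ uIcc x.1.left y ∪ uIcc x.1.left z := by
        intro v hv
        simp only [mem_union, mem_uIcc, mem_Icc] at hv hw ⊢
        grind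
      have hy' := hy c hc
      have hz' := hz c hc
      exact ⟨fun h => (hsub h).elim hy'.1 hz'.1, fun h => (hsub h).elim hy'.2 hz'.2⟩
    have hxI : x.1.left ∈ I := by
      intro c hc
      rw [uIcc_self, mem_singleton_iff, mem_singleton_iff]
      refine ⟨fun h => hxR ?_, fun h => x.1.left_ne_right c h.symm⟩
      rwa [← Chord.ext_left h]
    have hRI : ∀ c ∈ R, c.left ∉ I ∧ c.right ∉ I := fun c hc =>
      ⟨fun h => (h c hc).1 right_mem_uIcc, fun h => (h c hc).2 right_mem_uIcc⟩
    -- no chord of the component of `r` lies under a chord outside of that component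
    have hout : ∀ c ∈ W, c ∉ R → ∀ d ∈ R, ¬ (c.left < d.left ∧ d.right < c.right) := by
      rintro c hcW hcR d ⟨hdW, hd⟩
      have key := hd.closed_under_adj
        (P := fun e => e.1 ∈ R ∧ ¬ (c.left < e.1.left ∧ e.1.right < c.right))
        (fun e f hef he => ?_) ⟨hrR, fun h => (h.1.trans (hr' c hcW ?_)).false⟩
      · exact key.2
      · have hf : f.1 ∈ R := ⟨f.2, he.1.2.trans hef.reachable⟩
        refine ⟨hf, fun hfc => he.2 ?_⟩
        have h₁ := hRcross _ he.1 c hcW hcR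
        have h₂ := e.1.left_lt_right
        have h₃ := f.1.left_lt_right
        have h₄ := c.left_ne_right e.1
        have h₅ := e.1.left_ne_right c
        have h₆ : e.1.left ≠ c.left := fun h => hcR (Chord.ext_left h ▸ he.1)
        have h₇ : e.1.right ≠ c.right := fun h => hcR (Chord.ext_right h ▸ he.1)
        have h₈ : Cross e.1 f.1 := hef
        unfold Cross at h₁ h₈
        grind
      · rintro rfl
        exact hcR hrR
    have hsep : ∀ c ∈ W, c.left ∈ I ↔ c.right ∈ I := by
      intro c hcW
      by_cases hcR : c ∈ R
      · exact iff_of_false (hRI c hcR).1 (hRI c hcR).2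
      · have hlt := c.left_lt_right
        have key : ∀ d ∈ R, (d.left ∉ Icc c.left c.right) ∧ d.right ∉ Icc c.left c.right := by
          intro d hd
          have h₀ := hout c hcW hcR d hd
          have h₁ := hRcross _ hd c hcW hcR
          have h₂ := d.left_lt_right
          have h₄ := c.left_ne_right d
          have h₅ := d.left_ne_right c
          have h₆ : d.left ≠ c.left := fun h => hcR (Chord.ext_left h ▸ hd)
          have h₇ : d.right ≠ c.right := fun h => hcR (Chord.ext_right h ▸ hd)
          unfold Cross at h₁
          simp only [mem_Icc]
          grind
        constructor
        · intro h d hd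
          have h₁ := h d hd
          have h₂ := key d hd
          simp only [mem_uIcc, mem_Icc] at h₁ h₂ ⊢
          grind
        · intro h d hd
          have h₁ := h d hd
          have h₂ := key d hd
          simp only [mem_uIcc, mem_Icc] at h₁ h₂ ⊢
          grind
    rcases hW I hI hsep with h | h
    · exact (hRI r hrR).1 (h r hrW)
    · exact h x.1 x.2 hxI

lemma forall_chord_iff {I : Set (Fin (2 * n))} :
    (∀ c : D.Chord, c.left ∈ I ↔ c.right ∈ I) ↔ ∀ a ∈ I, D.1 a ∈ I := by
  constructor
  · intro h a ha
    obtain ⟨c, ⟨hl, hr⟩ | ⟨hl, hr⟩⟩ := D.exists_chord a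
    · have := h c
      rw [hl, hr] at this
      exact this.1 ha
    · have := h c
      rw [hl, hr] at this
      exact this.2 ha
  · exact fun h c => ⟨fun hc => c.apply_left ▸ h _ hc, fun hc => c.apply_right ▸ h _ hc⟩

/-- A diagram is connected iff no proper nonempty interval of nodes is matched within itself. -/
lemma isConnected_iff : D.IsConnected ↔ 0 < n ∧ ∀ I : Set (Fin (2 * n)),
    I.OrdConnected → (∀ a ∈ I, D.1 a ∈ I) → I = univ ∨ I = ∅ := by
  rw [IsConnected, ← D.intersectionGraph.induceUnivIso.connected_iff, connected_induce_iff]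
  simp only [mem_univ, forall_const, forall_chord_iff]
  refine and_congr ⟨fun ⟨c, _⟩ => ?_, fun hn => ?_⟩ (forall_congr' fun I => forall_congr' fun _ =>
    forall_congr' fun hcl => or_congr ⟨fun h => ?_, fun h => ?_⟩ ⟨fun h => ?_, fun h => ?_⟩)
  · have := c.left.2
    omega
  · obtain ⟨c, -⟩ := D.exists_chord ⟨0, by omega⟩
    exact ⟨c, trivial⟩
  · refine eq_univ_of_forall fun a => ?_
    obtain ⟨c, ⟨hl, hr⟩ | ⟨hl, hr⟩⟩ := D.exists_chord a
    · exact hl ▸ h c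
    · have := hcl _ (h c)
      rwa [hl, D.apply_apply] at this
  · simp [h]
  · refine eq_empty_of_forall_notMem fun a ha => ?_
    obtain ⟨c, ⟨hl, hr⟩ | ⟨hl, hr⟩⟩ := D.exists_chord a
    · exact h c (hl ▸ ha)
    · exact h c (hl ▸ hcl _ ha)
  · simp [h]

/-- A connected diagram is `2`-connected iff it has at least two chords and every interval of nodes
left by exactly one chord, or its complement, consists of a single node. -/
lemma isKConnected_two_iff : D.IsKConnected 2 ↔ D.IsConnected ∧ 1 < n ∧
    ∀ I : Set (Fin (2 * n)), I.OrdConnected → (∃! a, a ∈ I ∧ D.1 a ∉ I) →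
      I.Subsingleton ∨ Iᶜ.Subsingleton := by
  have : Finite D.Chord := Subtype.finite
  constructor
  · -- if a single chord leaves `I`, its deletion separates the chords in `I` from the others
    intro h
    have hconn : D.IsConnected := by
      have := h ∅ (by simp)
      rw [compl_empty] at this
      exact D.intersectionGraph.induceUnivIso.connected_iff.1 this
    have h₁ : ∀ c : D.Chord, _ := fun c => connected_induce_iff.1 (h {c} (by simp))
    refine ⟨hconn, ?_, fun I hI hleg => ?_⟩
    · obtain ⟨c⟩ := hconn.nonempty
      obtain ⟨d, hd⟩ := (h₁ c).1
      have e₁ : (c.left : ℕ) ≠ d.left := fun h => hd (Chord.ext_left (Fin.ext h)).symm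
      have e₂ : (d.left : ℕ) ≠ c.right := fun h => d.left_ne_right c (Fin.ext h)
      have e₃ : (c.left : ℕ) < c.right := c.left_lt_right
      have e₄ := c.right.2
      have e₅ := d.left.2
      omega
    · obtain ⟨a, ⟨haI, ha⟩, hu⟩ := hleg
      obtain ⟨c, hc⟩ := D.exists_chord a
      have hnode : ∀ x, x ≠ a → x ≠ D.1 a → ∃ d : D.Chord, d ≠ c ∧
          (d.left = x ∧ d.right = D.1 x ∨ d.left = D.1 x ∧ d.right = x) := by
        intro x hxa hxa'
        obtain ⟨d, hd⟩ := D.exists_chord x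
        refine ⟨d, ?_, hd⟩
        rintro rfl
        grind
      have hmem : ∀ x, x ≠ a → x ≠ D.1 a → (x ∈ I ↔ D.1 x ∈ I) := by
        intro x hxa hxa'
        constructor
        · intro hx
          by_contra hx'
          exact hxa (hu x ⟨hx, hx'⟩)
        · intro hx
          by_contra hx'
          refine hxa' ?_
          rw [← hu (D.1 x) ⟨hx, by rwa [D.apply_apply]⟩, D.apply_apply]
      have hsep : ∀ d ∈ ({c}ᶜ : Set D.Chord), d.left ∈ I ↔ d.right ∈ I := by
        intro d hd
        rw [← d.apply_left]
        refine hmem _ (fun e => hd ?_) fun e => hd ?_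
        · rcases hc with hc | hc
          · exact Chord.ext_left (e.trans hc.1.symm)
          · exact absurd (e.trans hc.2.symm) (d.left_ne_right c)
        · rcases hc with hc | hc
          · exact absurd (e.trans hc.2.symm) (d.left_ne_right c)
          · exact Chord.ext_left (e.trans hc.1.symm)
      rcases (h₁ c).2 I hI hsep with hall | hnone
      · right
        have key : ∀ x ∈ Iᶜ, x = D.1 a := by
          intro x hx
          by_contra hxa
          have hxa' : x ≠ a := fun e => hx (e ▸ haI)
          obtain ⟨d, hdc, ⟨hl, hr⟩ | ⟨hl, hr⟩⟩ := hnode x hxa' hxa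
          · exact hx (hl ▸ hall d hdc)
          · exact hx ((hmem x hxa' hxa).2 (hl ▸ hall d hdc))
        exact fun x hx y hy => (key x hx).trans (key y hy).symm
      · left
        have key : ∀ x ∈ I, x = a := by
          intro x hx
          by_contra hxa
          have hxa' : x ≠ D.1 a := fun e => ha (e ▸ hx)
          obtain ⟨d, hdc, ⟨hl, hr⟩ | ⟨hl, hr⟩⟩ := hnode x hxa hxa'
          · exact hnone d hdc (hl ▸ hx)
          · exact hnone d hdc (hl ▸ (hmem x hxa hxa').1 hx)
        exact fun x hx y hy => (key x hx).trans (key y hy).symm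
  · rintro ⟨hconn, hn, hpod⟩ T hT
    obtain ⟨-, hclosed⟩ := isConnected_iff.1 hconn
    -- intervals that no chord leaves
    have hall : ∀ I : Set (Fin (2 * n)), I.OrdConnected →
        (∀ c : D.Chord, c.left ∈ I ↔ c.right ∈ I) →
        (∀ c ∈ Tᶜ, c.left ∈ I) ∨ ∀ c ∈ Tᶜ, c.left ∉ I := by
      intro I hI h
      rcases hclosed I hI (forall_chord_iff.1 h) with rfl | rfl <;> simp
    rw [connected_induce_iff]
    rcases (Nat.lt_succ_iff.1 hT).lt_or_eq with h0 | h1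
    · obtain rfl : T = ∅ := (Set.ncard_eq_zero T.toFinite).1 (Nat.lt_one_iff.1 h0)
      obtain ⟨c⟩ := hconn.nonempty
      exact ⟨⟨c, by simp⟩, fun I hI h => hall I hI fun c => h c (by simp)⟩
    · obtain ⟨c, rfl⟩ := Set.ncard_eq_one.1 h1
      refine ⟨?_, fun I hI h => ?_⟩
      · obtain ⟨x, hx₁, hx₂⟩ : ∃ x, x ≠ c.left ∧ x ≠ c.right := by
          by_contra! hx
          have : (Finset.univ : Finset (Fin (2 * n))) ⊆ {c.left, c.right} := fun x _ => by
            rw [Finset.mem_insert, Finset.mem_singleton]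
            exact or_iff_not_imp_left.2 (hx x)
          have := (Finset.card_le_card this).trans Finset.card_le_two
          rw [Finset.card_univ, Fintype.card_fin] at this
          omega
        obtain ⟨d, hd⟩ := D.exists_chord x
        refine ⟨d, ?_⟩
        rintro rfl
        grind
      · by_cases hc : c.left ∈ I ↔ c.right ∈ I
        · refine hall I hI fun d => ?_
          by_cases hdc : d = c
          · rwa [hdc]
          · exact h d hdc
        · have hleg : ∃! a, a ∈ I ∧ D.1 a ∉ I := by
            have key : ∀ x, x ∈ I → D.1 x ∉ I → x = c.left ∨ x = c.right := by
              intro x hx hx'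
              obtain ⟨d, hd⟩ := D.exists_chord x
              have hdc : d = c := by
                by_contra hdc
                have := h d hdc
                rcases hd with ⟨hl, hr⟩ | ⟨hl, hr⟩
                · exact hx' (hr ▸ this.1 (hl ▸ hx))
                · exact hx' (hl ▸ this.2 (hr ▸ hx))
              subst hdc
              grind
            by_cases hl : c.left ∈ I
            · have hr : c.right ∉ I := fun hr => hc (iff_of_true hl hr)
              refine ⟨c.left, ⟨hl, by rwa [c.apply_left]⟩, fun y hy => ?_⟩
              exact (key y hy.1 hy.2).resolve_right fun e => hr (e ▸ hy.1)
            · have hr : c.right ∈ I := by_contra fun hr => hc (iff_of_false hl hr)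
              refine ⟨c.right, ⟨hr, by rwa [c.apply_right]⟩, fun y hy => ?_⟩
              exact (key y hy.1 hy.2).resolve_left fun e => hl (e ▸ hy.1)
          rcases hpod I hI hleg with hs | hs
          · refine Or.inr fun d hd hdI => ?_
            exact d.left_lt_right.ne (hs hdI ((h d hd).1 hdI))
          · refine Or.inl fun d hd => ?_
            by_contra hdI
            exact d.left_lt_right.ne (hs hdI fun hr => hdI ((h d hd).2 hr))

end ChordDiagram

/-! ### Chord diagrams as open diagrams -/

namespace ChordDiagram

open Set Function OpenDiagram

variable {n : ℕ} {D : ChordDiagram n} {r : Fin (2 * n)}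

open Classical in
/-- Delete the node `r`; its partner becomes a fixed point. -/
noncomputable def toOpen (D : ChordDiagram n) (r : Fin (2 * n)) (a : {i // i ≠ r}) :
    {i // i ≠ r} :=
  if h : D.1 a = r then a else ⟨D.1 a, h⟩

lemma toOpen_of_eq {a : {i // i ≠ r}} (h : D.1 a = r) : D.toOpen r a = a := dif_pos h

lemma toOpen_of_ne {a : {i // i ≠ r}} (h : D.1 a ≠ r) : D.toOpen r a = ⟨D.1 a, h⟩ := dif_neg h

lemma toOpen_eq_self_iff {a : {i // i ≠ r}} : D.toOpen r a = a ↔ D.1 a = r := by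
  by_cases h : D.1 a = r
  · exact iff_of_true (toOpen_of_eq h) h
  · rw [toOpen_of_ne h, Subtype.ext_iff]
    exact iff_of_false (D.apply_ne a) h

lemma involutive_toOpen (D : ChordDiagram n) (r : Fin (2 * n)) : Involutive (D.toOpen r) := by
  intro a
  by_cases h : D.1 a = r
  · rw [toOpen_of_eq h, toOpen_of_eq h]
  · rw [toOpen_of_ne h, toOpen_of_ne (by simpa [D.apply_apply] using a.2)]
    simp [D.apply_apply]

lemma existsUnique_toOpen_eq_self (D : ChordDiagram n) (r : Fin (2 * n)) :
    ∃! a, D.toOpen r a = a := by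
  simp only [toOpen_eq_self_iff]
  refine ⟨⟨D.1 r, D.apply_ne r⟩, D.apply_apply r, fun b hb => Subtype.ext ?_⟩
  exact D.1.injective (hb.trans (D.apply_apply r).symm)

lemma isLeg_toOpen {I : Set {i // i ≠ r}} {a : {i // i ≠ r}} :
    IsLeg (D.toOpen r) I a ↔ a.1 ∈ Subtype.val '' I ∧ D.1 a ∉ Subtype.val '' I := by
  rw [IsLeg, toOpen_eq_self_iff]
  by_cases h : D.1 a = r
  · simp [h, a.2]
  · rw [toOpen_of_ne h]
    simp [h, a.2]

lemma toOpen_injective (r : Fin (2 * n)) : Injective fun D : ChordDiagram n => D.toOpen r := by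
  intro D D' h
  have hr : ∀ a, a ≠ r → (D.1 a = r ↔ D'.1 a = r) := fun a ha => by
    have e : D.toOpen r ⟨a, ha⟩ = D'.toOpen r ⟨a, ha⟩ := congr_fun h _
    rw [← toOpen_eq_self_iff (a := ⟨a, ha⟩), e, toOpen_eq_self_iff]
  refine Subtype.ext (Equiv.ext fun a => ?_)
  by_cases ha : a = r
  · subst ha
    refine D'.1.injective ?_
    rw [D'.apply_apply]
    exact (hr _ (D.apply_ne a)).1 (D.apply_apply a)
  · by_cases h' : D.1 a = r
    · rw [h', (hr a ha).1 h']
    · have e : D.toOpen r ⟨a, ha⟩ = D'.toOpen r ⟨a, ha⟩ := congr_fun h _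
      rw [toOpen_of_ne h', toOpen_of_ne fun h'' => h' ((hr a ha).2 h'')] at e
      exact congr_arg Subtype.val e

lemma exists_toOpen_eq {τ : {i // i ≠ r} → {i // i ≠ r}} (hτ : Involutive τ)
    (hfix : ∃! a, τ a = a) : ∃ D : ChordDiagram n, D.toOpen r = τ := by
  classical
  obtain ⟨p, hp, hu⟩ := hfix
  let σ : Fin (2 * n) → Fin (2 * n) := fun i =>
    if h : i = r then p else if τ ⟨i, h⟩ = ⟨i, h⟩ then r else τ ⟨i, h⟩
  have hσr : σ r = p := dif_pos rfl
  have hσp : ∀ a, τ a = a → σ a = r := fun a ha => by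
    simp only [σ]
    rw [dif_neg a.2, if_pos ha]
  have hσ : ∀ a, τ a ≠ a → σ a = τ a := fun a ha => by
    simp only [σ]
    rw [dif_neg a.2, if_neg ha]
  have hcases : ∀ i, i = r ∨ (∃ a : {i // i ≠ r}, a = p ∧ i = a) ∨
      ∃ a : {i // i ≠ r}, τ a ≠ a ∧ i = a := fun i => by
    by_cases h : i = r
    · exact Or.inl h
    · by_cases h' : τ ⟨i, h⟩ = ⟨i, h⟩
      · exact Or.inr (Or.inl ⟨⟨i, h⟩, hu _ h', rfl⟩)
      · exact Or.inr (Or.inr ⟨⟨i, h⟩, h', rfl⟩)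
  have hinv : Involutive σ := by
    intro i
    rcases hcases i with rfl | ⟨a, rfl, rfl⟩ | ⟨a, ha, rfl⟩
    · rw [hσr, hσp p hp]
    · rw [hσp a hp, hσr]
    · rw [hσ a ha, hσ (τ a) (by rw [hτ a]; exact ha.symm), hτ a]
  have hne : ∀ i, σ i ≠ i := by
    intro i
    rcases hcases i with rfl | ⟨a, rfl, rfl⟩ | ⟨a, ha, rfl⟩
    · rw [hσr]
      exact p.2
    · rw [hσp a hp]
      exact a.2.symm
    · rw [hσ a ha]
      exact fun h => ha (Subtype.ext h)
  refine ⟨⟨hinv.toPerm, hinv, hne⟩, funext fun a => ?_⟩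
  by_cases ha : τ a = a
  · rw [ha]
    exact toOpen_of_eq (hσp a ha)
  · have e : σ a ≠ r := by
      rw [hσ a ha]
      exact (τ a).2
    exact (toOpen_of_ne e).trans (Subtype.ext (hσ a ha))

lemma image_preimage_val_of_notMem {I : Set (Fin (2 * n))} (h : r ∉ I) :
    Subtype.val '' (Subtype.val ⁻¹' I : Set {i // i ≠ r}) = I :=
  image_preimage_eq_of_subset fun y hy => ⟨⟨y, fun e => h (e ▸ hy)⟩, rfl⟩

lemma ordConnected_setOf_ne (hr : ∀ i, r ≤ i) : {i | i ≠ r}.OrdConnected := by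
  refine ⟨fun x hx y _ z hz hzr => ?_⟩
  have hx' : x ≠ r := hx
  exact hx' (le_antisymm (hzr ▸ hz.1) (hr x))

lemma isOpenConnected_toOpen_iff (hr : ∀ i, r ≤ i) :
    IsOpenConnected (D.toOpen r) ↔ D.IsConnected := by
  have hn : 0 < n := by
    have := r.2
    omega
  rw [isConnected_iff, and_iff_right hn]
  constructor
  · intro h I hI hcl
    -- the case of an interval that avoids `r`
    have key : ∀ I : Set (Fin (2 * n)), I.OrdConnected → (∀ a ∈ I, D.1 a ∈ I) → r ∉ I → I = ∅ := by
      intro I hI hcl hrI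
      by_contra! hne
      obtain ⟨x, hx⟩ := hne
      have e : Subtype.val '' (Subtype.val ⁻¹' I : Set {i // i ≠ r}) = I :=
        image_preimage_val_of_notMem hrI
      obtain ⟨a, ha⟩ := h.exists_isLeg (Subtype.val ⁻¹' I)
        (hI.preimage_mono (Subtype.mono_coe _)) ⟨⟨x, fun hxr => hrI (hxr ▸ hx)⟩, hx⟩
      rw [isLeg_toOpen, e] at ha
      exact ha.2 (hcl _ ha.1)
    by_cases hrI : r ∈ I
    · left
      rw [← compl_empty_iff]
      refine key _ ⟨fun x hx y hy z hz hzI => hx (hI.out hrI hzI ⟨hr x, hz.1⟩)⟩ (fun a ha h => ?_)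
        (not_not_intro hrI)
      exact ha (by simpa [D.apply_apply] using hcl _ h)
    · exact Or.inr (key I hI hcl hrI)
  · intro h
    refine ⟨D.involutive_toOpen r, D.existsUnique_toOpen_eq_self r, fun J hJ hne => ?_⟩
    by_contra! hno
    have hcl : ∀ a ∈ Subtype.val '' J, D.1 a ∈ Subtype.val '' J := by
      rintro _ ⟨b, hb, rfl⟩
      by_contra h'
      exact hno b (isLeg_toOpen.2 ⟨⟨b, hb, rfl⟩, h'⟩)
    rcases h (Subtype.val '' J) (ordConnected_image_val
      (ordConnected_setOf_ne hr) hJ) hcl with e | e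
    · obtain ⟨b, -, hb⟩ : r ∈ Subtype.val '' J := e ▸ mem_univ r
      exact b.2 hb
    · exact (hne.image Subtype.val).ne_empty e

/-- Intervals containing the first node `r` are traded for their complements, which are intervals
with the same number of legs. -/
lemma isSimple_toOpen_iff (hr : ∀ i, r ≤ i) :
    IsSimple (D.toOpen r) ↔ D.IsKConnected 2 := by
  have hbij : ∀ J : Set {i // i ≠ r}, (∃! a, IsLeg (D.toOpen r) J a) ↔
      ∃! a, a ∈ Subtype.val '' J ∧ D.1 a ∉ Subtype.val '' J := by
    intro J
    simp only [isLeg_toOpen]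
    constructor
    · rintro ⟨a, ha, hu⟩
      refine ⟨a, ha, fun y hy => ?_⟩
      obtain ⟨b, hb, rfl⟩ := hy.1
      exact congr_arg Subtype.val (hu b hy)
    · rintro ⟨a, ha, hu⟩
      obtain ⟨b, hb, rfl⟩ := ha.1
      exact ⟨b, ha, fun y hy => Subtype.ext (hu y hy)⟩
  have hnontriv : Nontrivial {i : Fin (2 * n) // i ≠ r} ↔ 1 < n := by
    rw [← Fintype.one_lt_card_iff_nontrivial]
    simp only [ne_eq, Fintype.card_subtype_compl, Fintype.card_fin, Fintype.card_unique]
    omega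
  have hcompl : ∀ I : Set (Fin (2 * n)), I.OrdConnected → r ∈ I → Iᶜ.OrdConnected :=
    fun I hI hrI => ⟨fun x hx y hy z hz hzI => hx (hI.out hrI hzI ⟨hr x, hz.1⟩)⟩
  rw [isKConnected_two_iff, ← isOpenConnected_toOpen_iff hr, ← hnontriv]
  constructor
  · intro h
    refine ⟨h.isOpenConnected, h.nontrivial, ?_⟩
    have key : ∀ I : Set (Fin (2 * n)), I.OrdConnected → (∃! a, a ∈ I ∧ D.1 a ∉ I) → r ∉ I →
        I.Subsingleton ∨ Iᶜ.Subsingleton := by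
      intro I hI hleg hrI
      have e : Subtype.val '' (Subtype.val ⁻¹' I : Set {i // i ≠ r}) = I :=
        image_preimage_val_of_notMem hrI
      rcases h.pod (Subtype.val ⁻¹' I) ⟨hI.preimage_mono (Subtype.mono_coe _),
        (hbij _).2 (by rwa [e])⟩ with hs | hs
      · rw [← e]
        exact Or.inl (hs.image _)
      · right
        have : ∀ x ∈ Iᶜ, x = r := fun x hx => by
          by_contra hxr
          have : (⟨x, hxr⟩ : {i // i ≠ r}) ∈ (Subtype.val ⁻¹' I : Set {i // i ≠ r}) :=
            hs ▸ mem_univ _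
          exact hx this
        exact fun x hx y hy => (this x hx).trans (this y hy).symm
    intro I hI hleg
    by_cases hrI : r ∈ I
    · rw [or_comm]
      have := key Iᶜ (hcompl I hI hrI) ?_ (not_not_intro hrI)
      · rwa [compl_compl] at this
      · obtain ⟨a, ⟨ha, ha'⟩, hu⟩ := hleg
        refine ⟨D.1 a, ⟨ha', not_not_intro (by rwa [D.apply_apply])⟩, fun y hy => ?_⟩
        rw [← hu (D.1 y) ⟨not_not.1 hy.2, by rw [D.apply_apply]; exact hy.1⟩, D.apply_apply]
    · exact key I hI hleg hrI
  · rintro ⟨h₁, h₂, h₃⟩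
    refine ⟨h₁, h₂, fun J hJ => ?_⟩
    rcases h₃ (Subtype.val '' J) (ordConnected_image_val
      (ordConnected_setOf_ne hr) hJ.1) ((hbij J).1 hJ.2) with
      hs | hs
    · exact Or.inl fun x hx y hy => Subtype.ext (hs ⟨x, hx, rfl⟩ ⟨y, hy, rfl⟩)
    · refine Or.inr (eq_univ_of_forall fun x => ?_)
      by_contra hx
      refine x.2 (hs ?_ ?_)
      · rintro ⟨y, hy, hyx⟩
        exact hx (Subtype.ext hyx ▸ hy)
      · rintro ⟨y, hy, hyr⟩
        exact y.2 hyr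

lemma card_eq_card_of_toOpen_iff {P : ChordDiagram n → Prop}
    {Q : ({i // i ≠ r} → {i // i ≠ r}) → Prop}
    (h : ∀ D, Q (D.toOpen r) ↔ P D) (hQ : ∀ τ, Q τ → IsOpenConnected τ) :
    Nat.card {D // P D} = Nat.card {τ // Q τ} := by
  refine Nat.card_congr (Equiv.ofBijective (fun D => ⟨D.1.toOpen r, (h D.1).2 D.2⟩) ⟨?_, ?_⟩)
  · exact fun D D' e => Subtype.ext (toOpen_injective r (congr_arg Subtype.val e))
  · rintro ⟨τ, hτ⟩
    obtain ⟨D, rfl⟩ := exists_toOpen_eq (hQ τ hτ).involutive (hQ τ hτ).existsUnique_fixed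
    exact ⟨⟨D, (h D).1 hτ⟩, rfl⟩

lemma card_isConnected (m : ℕ) :
    Nat.card {D : ChordDiagram (m + 1) // D.IsConnected} = numOpen (2 * m + 1) := by
  let r : Fin (2 * (m + 1)) := ⟨0, by omega⟩
  have hr : ∀ i, r ≤ i := fun i => Nat.zero_le _
  rw [card_eq_card_of_toOpen_iff (fun D => isOpenConnected_toOpen_iff hr) fun _ h => h,
    card_isOpenConnected]
  simp only [ne_eq, Fintype.card_subtype_compl, Fintype.card_fin, Fintype.card_unique]
  rfl

lemma card_isKConnected_two (m : ℕ) :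
    Nat.card {D : ChordDiagram (m + 1) // D.IsKConnected 2} = numSimple (2 * m + 1) := by
  let r : Fin (2 * (m + 1)) := ⟨0, by omega⟩
  have hr : ∀ i, r ≤ i := fun i => Nat.zero_le _
  rw [card_eq_card_of_toOpen_iff (fun D => isSimple_toOpen_iff hr) fun _ h => h.isOpenConnected,
    card_isSimple]
  simp only [ne_eq, Fintype.card_subtype_compl, Fintype.card_fin, Fintype.card_unique]
  rfl

lemma card_isConnected_zero : Nat.card {D : ChordDiagram 0 // D.IsConnected} = 0 := by
  rw [Nat.card_eq_zero]
  exact Or.inl ⟨fun D => (isConnected_iff.1 D.2).1.false⟩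

lemma card_isKConnected_two_zero : Nat.card {D : ChordDiagram 0 // D.IsKConnected 2} = 0 := by
  rw [Nat.card_eq_zero]
  exact Or.inl ⟨fun D => (isConnected_iff.1 (isKConnected_two_iff.1 D.2).1).1.false⟩

end ChordDiagram

/-! ### The functional equation -/

/-- A diagram with `m + 1` chords has `2 * m + 1` nodes besides the root, whence the shift by `X`
between counting by chords and counting by open nodes. -/
lemma PowerSeries.expand_two_mk_eq {R : Type*} [CommRing R] {c f : ℕ → R} (h0 : c 0 = 0)
    (hodd : ∀ m, c (m + 1) = f (2 * m + 1)) (heven : ∀ n, Even n → f n = 0) :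
    expand 2 two_ne_zero (mk c) = X * mk f := by
  ext n
  rcases n with _ | n
  · rw [coeff_zero_X_mul, coeff_zero_eq_constantCoeff_apply, constantCoeff_expand,
      ← coeff_zero_eq_constantCoeff_apply, coeff_mk, h0]
  · rw [coeff_succ_X_mul, coeff_mk]
    rcases n.even_or_odd' with ⟨m, rfl | rfl⟩
    · rw [coeff_expand_of_not_dvd _ _ _ (by omega), heven _ (even_two_mul m)]
    · rw [show 2 * m + 1 + 1 = 2 * (m + 1) by ring, coeff_expand_mul, coeff_mk, hodd]

lemma PowerSeries.expand_injective {R : Type*} [CommRing R] {p : ℕ} (hp : p ≠ 0) :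
    Function.Injective (expand p hp : R⟦X⟧ →ₐ[R] R⟦X⟧) := by
  intro f g h
  ext n
  rw [← coeff_expand_mul p hp f, h, coeff_expand_mul]

namespace ChordDiagram

open OpenDiagram

lemma expand_connectedGF : expand 2 two_ne_zero connectedGF = X * openGF :=
  expand_two_mk_eq (by rw [card_isConnected_zero, Nat.cast_zero])
    (fun m => by rw [card_isConnected]) fun n hn => by rw [numOpen_of_even hn, Nat.cast_zero]

lemma expand_kConnectedGF_two : expand 2 two_ne_zero (kConnectedGF 2) = X * simpleGF :=
  expand_two_mk_eq (by rw [card_isKConnected_two_zero, Nat.cast_zero])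
    (fun m => by rw [card_isKConnected_two]) fun n hn => by rw [numSimple_of_even hn, Nat.cast_zero]

end ChordDiagram

open ChordDiagram OpenDiagram in
theorem proposition3p1 :
    ∃ T : ℤ⟦X⟧, X * T = ChordDiagram.connectedGF ^ 2 ∧ PowerSeries.constantCoeff T = 0 ∧
      ChordDiagram.connectedGF = T - (ChordDiagram.kConnectedGF 2).subst T := by
  obtain ⟨A, hA⟩ : (X : ℤ⟦X⟧) ∣ connectedGF := by
    rw [X_dvd_iff, ← coeff_zero_eq_constantCoeff_apply, connectedGF, coeff_mk,
      card_isConnected_zero, Nat.cast_zero]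
  have hT0 : constantCoeff (X * A ^ 2) = 0 := by simp
  have hX : (X : ℤ⟦X⟧) ≠ 0 := X_ne_zero
  have hF : openGF = X * expand 2 two_ne_zero A := by
    refine mul_left_cancel₀ hX ?_
    rw [← expand_connectedGF, hA, map_mul, expand_X]
    ring
  have hT : expand 2 two_ne_zero (X * A ^ 2) = openGF ^ 2 := by
    rw [hF, map_mul, map_pow, expand_X]
    ring
  have hF0 : HasSubst openGF := HasSubst.of_constantCoeff_zero' constantCoeff_openGF
  refine ⟨X * A ^ 2, by rw [hA]; ring, hT0, expand_injective two_ne_zero ?_⟩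
  have hsubst : expand 2 two_ne_zero ((kConnectedGF 2).subst (X * A ^ 2)) =
      openGF * simpleGF.subst openGF := by
    have e : (expand 2 two_ne_zero (kConnectedGF 2)).subst openGF =
        (kConnectedGF 2).subst (openGF ^ 2) := by
      rw [expand_apply, subst_comp_subst_apply (HasSubst.X_pow two_ne_zero) hF0, subst_pow hF0,
        subst_X hF0]
    rw [expand_kConnectedGF_two, subst_mul hF0, subst_X hF0] at e
    rw [e, ← hT]
    exact expand_subst 2 two_ne_zero (HasSubst.of_constantCoeff_zero' hT0) _
  -- multiplying `F = X + S(F)` by `F` turns it into `T(X²) = C(X²) + C_{≥ 2}(T)(X²)`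
  have h := congr_arg (openGF * ·) openGF_eq
  simp only [mul_add] at h
  rw [map_sub, hsubst, hT, expand_connectedGF, eq_sub_iff_add_eq, pow_two]
  rw [mul_comm X openGF]
  exact h.symm
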